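/- **Setting.** Let $s\ge 2$, $d,k\ge 0$, $m\ge 2$, $n\ge 1$. There are $m$ train manifolds $M_l=\{f(\gamma_l,\theta):\theta\in\Theta\}\subseteq\mathbb R^d$, with $f:\mathbb R^s\times\mathbb R^k\to\mathbb R^d$, $\Theta\subseteq\mathbb R^k$, unit-norm identifiers $\gamma_1,\dots,\gamma_m\in\mathbb R^s$ that are $\tau$-separated, $\langle\gamma_l,\gamma_j\rangle\le\tau$ for $l\ne j$ (where $\tau<1$), and $n$ train inputs $x_{il}\in M_l$ ($i\in[n]$) on each of them. All inputs (points of the $M_l$) have norm $1$. The manifolds are invertible: there is $g:\mathbb R^d\to\mathbb R^s$ with $g(x)=\gamma_l$ for all $x\in M_l$ and all $l$, and $\|g_i\|\le R$ for each coordinate $g_i$. Here, with $\sigma$ the ReLU and $x'=(x/\sqrt2,1/\sqrt2)\in\mathbb R^{d+1}$, the norm of $h:\mathbb R^d\to\mathbb R$ is its norm with respect to the infinite-width random ReLU layer, $$\|h\|=\inf\Big\{\|a\|_{L^2(N(0,I))}:\ h(x)=\mathbb E_{w\sim N(0,I_{d+1})}\big[a(w)\,\sigma(\langle w,x'\rangle)\big]\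 \text{ for all } \|x\|_2=1\Big\}.$$ The network is $\hat y(x)=AB\sigma(Cx')$ with $A\in\mathbb R^{m\times T}$, $B\in\mathbb R^{T\times D}$ and a random $C\in\mathbb R^{D\times(d+1)}$ whose rows are i.i.d. $N(0,\frac1D I)$. With one-hot labels the weighted square loss is $$\mathcal L_{A,B}=\frac1m\sum_{l=1}^m\frac1n\sum_{i=1}^n\Big(\tfrac12\big(1-\hat y_l(x_{il})\big)^2+\sum_{j\ne l}\tfrac1{2(m-1)}\,\hat y_j(x_{il})^2\Big).$$ A map $r:\mathbb R^d\to\mathbb R^T$ is $(\varepsilon,\rho)$-GSH with respect to $M_1,\dots,M_m$ if (A) $\|r(x)-r(y)\|_2^2\le\varepsilon$ for any two points $x,y$ of the same manifold $M_l$, and (B) $\|r(x)-r(y)\|_2^2\ge\rho$ for all $x\in M_l$, $y\in M_j$ with $l\ne j$. **Lemma (Existence of a good ground truth).** There are absolute constants $c,K_0>0$, and for every $\tau<1$ and $R\ge0$ a constant $K>0$ depending only on $\tau,R$, such that for all $m\ge2$, $n\ge1$, $0<\varepsilon\le\frac12$ and $0<\delta\le\frac12$ there is a hidden layer width $$T\le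 K_0\,\frac{\log(mn)\log(1/\delta)}{\varepsilon}$$ with the following property. For all $s\ge2$ and $d$, if the random layer is wide enough, $D\ge D_0$ with $D_0$ depending only on $\tau,R,m,n,\varepsilon,\delta,s,d$, then for all data as above, with probability at least $1-\delta$ over $C$, there are matrices $A^*\in\mathbb R^{m\times T}$ and $B^*\in\mathbb R^{T\times D}$ such that 1. $\mathcal L_{A^*,B^*}\le\varepsilon$; 2. $\|A^*\|_F^2\le m$ and $\|B^*\|_F^2\le s^{K\log(1/\varepsilon)}$; 3. $x\mapsto B^*\sigma(Cx')$ is $(\varepsilon,\,c/\varepsilon)$-GSH with respect to $M_1,\dots,M_m$. -/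

import Mathlib

open MeasureTheory ProbabilityTheory
open scoped ENNReal NNReal Matrix

noncomputable section

/-- The input with a constant appended, `x' = (x / √2, 1 / √2)`. -/
def augment {d : ℕ} (x : EuclideanSpace ℝ (Fin d)) : Fin (d + 1) → ℝ :=
  Fin.snoc (α := fun _ => ℝ) (fun i => x i / √2) (1 / √2)

/-- The ReLU activation. -/
def relu (t : ℝ) : ℝ := max t 0

/-- The output `σ(C x')` of the (non-trainable) ReLU layer with weight matrix `C`. -/
def reluLayer {D d : ℕ} (C : Fin D → Fin (d + 1) → ℝ) (x : EuclideanSpace ℝ (Fin d)) :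
    Fin D → ℝ :=
  fun i => relu (C i ⬝ᵥ augment x)

/-- The law of the random weight matrix `C`: the `D` rows are i.i.d. `N(0, I / D)`. -/
def layerLaw (D d : ℕ) : Measure (Fin D → Fin (d + 1) → ℝ) :=
  Measure.pi fun _ => Measure.pi fun _ => gaussianReal 0 ((D : ℝ≥0)⁻¹)

/-- The law `N(0, I)` of the (unnormalised) weight vector of one ReLU unit. -/
def unitLaw (d : ℕ) : Measure (Fin (d + 1) → ℝ) :=
  Measure.pi fun _ => gaussianReal 0 1

/-- `g ≡ a σ(C ·)` on unit-norm inputs, for a layer of infinite width: the units are indexed by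
their weight vectors `w ∼ N(0, I)`, and a linear functional of the layer is a square-integrable
function `a` of `w`. -/
def IsReluRepresentation {d : ℕ} (a : (Fin (d + 1) → ℝ) → ℝ)
    (g : EuclideanSpace ℝ (Fin d) → ℝ) : Prop :=
  MemLp a 2 (unitLaw d) ∧
    ∀ x : EuclideanSpace ℝ (Fin d), ‖x‖ = 1 →
      g x = ∫ w, a w * relu (w ⬝ᵥ augment x) ∂(unitLaw d)

/-- The norm of `g` with respect to the infinite-width ReLU layer: the least `L²` norm of an `a`
with `g ≡ a σ(C ·)`; it is `∞` if there is no such `a`. -/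
def reluNorm {d : ℕ} (g : EuclideanSpace ℝ (Fin d) → ℝ) : ℝ≥0∞ :=
  ⨅ (a : (Fin (d + 1) → ℝ) → ℝ) (_ : IsReluRepresentation a g), eLpNorm a 2 (unitLaw d)

/-- The manifold with identifier `γ`: all points `f(γ, θ)` with `θ ∈ Θ`. -/
def manifold {s k d : ℕ}
    (f : EuclideanSpace ℝ (Fin s) → EuclideanSpace ℝ (Fin k) → EuclideanSpace ℝ (Fin d))
    (Θ : Set (EuclideanSpace ℝ (Fin k))) (γ : EuclideanSpace ℝ (Fin s)) :
    Set (EuclideanSpace ℝ (Fin d)) :=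
  f γ '' Θ

/-- The representation `r(x) = B σ(C x')`. -/
def representation {T D d : ℕ} (B : Matrix (Fin T) (Fin D) ℝ) (C : Fin D → Fin (d + 1) → ℝ)
    (x : EuclideanSpace ℝ (Fin d)) : EuclideanSpace ℝ (Fin T) :=
  WithLp.toLp 2 (B *ᵥ reluLayer C x)

/-- The prediction `ŷ(x) = A B σ(C x')`. -/
def prediction {m T D d : ℕ} (A : Matrix (Fin m) (Fin T) ℝ) (B : Matrix (Fin T) (Fin D) ℝ)
    (C : Fin D → Fin (d + 1) → ℝ) (x : EuclideanSpace ℝ (Fin d)) : Fin m → ℝ :=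
  A *ᵥ (B *ᵥ reluLayer C x)

/-- The weights: the squared error at the correct coordinate counts with factor `1/2`, the squared
error at each of the other `m - 1` coordinates with factor `1/(2(m-1))`. -/
def classWeight {m : ℕ} (l j : Fin m) : ℝ :=
  if j = l then √(1 / 2) else √(1 / (2 * ((m : ℝ) - 1)))

/-- The weighted square loss `(1/m) ∑_l (1/n) ∑_i ‖w_l ⊙ (y_{il} - ŷ_{il})‖₂²`, where `y_{il}` is
the one-hot label `e_l`. -/
def weightedSquareLoss {m n T D d : ℕ} (A : Matrix (Fin m) (Fin T) ℝ)
    (B : Matrix (Fin T) (Fin D) ℝ) (C : Fin D → Fin (d + 1) → ℝ)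
    (x : Fin n → Fin m → EuclideanSpace ℝ (Fin d)) : ℝ :=
  (1 / (m : ℝ)) * ∑ l : Fin m, (1 / (n : ℝ)) * ∑ i : Fin n, ∑ j : Fin m,
    (classWeight l j * ((Pi.single l 1 : Fin m → ℝ) j - prediction A B C (x i l) j)) ^ 2

/-- The squared Frobenius norm. -/
def frobeniusSq {p q : ℕ} (A : Matrix (Fin p) (Fin q) ℝ) : ℝ :=
  ∑ i, ∑ j, A i j ^ 2

/-- `r` is an `(ε, ρ)`-geometry sensitive hash with respect to the manifolds `M l`. -/
structure IsGSH {m d T : ℕ} (M : Fin m → Set (EuclideanSpace ℝ (Fin d)))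
    (r : EuclideanSpace ℝ (Fin d) → EuclideanSpace ℝ (Fin T)) (ε ρ : ℝ) : Prop where
  near : ∀ l, ∀ x ∈ M l, ∀ y ∈ M l, ‖r x - r y‖ ^ 2 ≤ ε
  far : ∀ l j, l ≠ j → ∀ x ∈ M l, ∀ y ∈ M j, ρ ≤ ‖r x - r y‖ ^ 2

end

/-! The ground truth is explicit. For an identifier `γ` take the degree `p` tensor power `φ` of
`(γ/√2, 1/√2)`. For two identifiers the inner product of these features is `((1 + ⟨γ, γ'⟩)/2)^p`: it
equals `1` on the diagonal, and off the diagonal it lies between `0` and `√ε/8` once `p` is a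
suitable multiple of `log(1/ε)`. A Gaussian projection `G` to dimension `T` of order `log m / ε`
keeps all these inner products up to `√ε/8` (`exists_matrix_preserving_inner`), so the vectors `u l
= G φ_l / √T` are almost orthonormal. If `B σ(C x')` is close to `u l / √ε` on the manifold of `γ
l`, then `A = √ε uᵀ` predicts the labels up to `√ε`, and the representation is nearly constant on
each manifold, with squared distances of order `1/ε` between manifolds
(`exists_groundTruth_of_approx`).

It remains to realise `x ↦ G φ(g x)` by the random layer with controlled norm. On the sphere the
layer has kernel `∑ b_n ⟨x, y⟩^n` with all `b_n > 0` of order `n^(-5/2)` (`reluCoeff`). Such a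
sequence is dominated by itself under convolution, `b * b ≤ L b` (`reluCoeff_conv_le`), and the
kernels `⟨x, y⟩^n` are positive semidefinite. Hence the square of the kernel is at most `L` times
the kernel, and the reproducing kernel Hilbert space is closed under products up to a constant
(`exists_reluBound_mul`). Since the coordinates of `g` have bounded norm, a degree `p` monomial in
them has norm at most `c V^p`, and summing over the `(s+1)^p` monomials gives `s^(O(log(1/ε)))`. The
Riesz representation theorem turns these norm bounds into `L²` weights for the infinite layer
(`ReluBound.exists_representation`).

The passage to finite width is Monte Carlo sampling: truncated weights, Chebyshev's inequality, and
a net of the sphere (`exists_width`). It is applied to each of the `T` rows of `B` with failure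
probability `δ/T`. -/

noncomputable section

/-! ### Inverse square root series and the size of their coefficients. -/

/-- The Taylor coefficients of `(1 - u) ^ (-1/2)` at `0`. -/
def invSqrtCoeff (n : ℕ) : ℝ := Ring.multichoose (1 / 2 : ℝ) n

theorem invSqrtCoeff_zero : invSqrtCoeff 0 = 1 := by
  simp [invSqrtCoeff]

theorem invSqrtCoeff_succ (n : ℕ) :
    invSqrtCoeff (n + 1) = invSqrtCoeff n * ((2 * n + 1) / (2 * n + 2)) := by
  have h1 := Ring.factorial_nsmul_multichoose_eq_ascPochhammer (1 / 2 : ℝ) n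
  have h2 := Ring.factorial_nsmul_multichoose_eq_ascPochhammer (1 / 2 : ℝ) (n + 1)
  rw [Polynomial.ascPochhammer_smeval_eq_eval] at h1 h2
  rw [ascPochhammer_succ_eval, ← h1, Nat.factorial_succ] at h2
  simp only [nsmul_eq_mul] at h2
  push_cast at h2
  have h3 : ((n.factorial : ℕ) : ℝ) ≠ 0 := by positivity
  unfold invSqrtCoeff
  have h4 : ((n : ℝ) + 1) * Ring.multichoose (1 / 2 : ℝ) (n + 1)
      = Ring.multichoose (1 / 2 : ℝ) n * (1 / 2 + n) := by
    apply mul_left_cancel₀ h3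
    linear_combination h2
  have h5 : (n : ℝ) + 1 ≠ 0 := by positivity
  have h6 : (2 * n + 2 : ℝ) ≠ 0 := by positivity
  field_simp
  linear_combination 2 * h4

theorem invSqrtCoeff_pos (n : ℕ) : 0 < invSqrtCoeff n := by
  induction n with
  | zero => simp [invSqrtCoeff_zero]
  | succ n ih => rw [invSqrtCoeff_succ]; positivity

theorem invSqrtCoeff_le_one (n : ℕ) : invSqrtCoeff n ≤ 1 := by
  induction n with
  | zero => simp [invSqrtCoeff_zero]
  | succ n ih =>
    rw [invSqrtCoeff_succ]
    have : ((2 * n + 1) / (2 * n + 2) : ℝ) ≤ 1 := by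
      rw [div_le_one (by positivity)]; linarith
    exact mul_le_one₀ ih (by positivity) this

/-- The ratio `(2n+1)/(2n+2)` of consecutive coefficients increases with `n`, so shifting the index
by `i` only enlarges each factor. -/
theorem invSqrtCoeff_mul_le (i j : ℕ) :
    invSqrtCoeff i * invSqrtCoeff j ≤ invSqrtCoeff (i + j) := by
  induction j with
  | zero => simp [invSqrtCoeff_zero]
  | succ j ih =>
    rw [← add_assoc, invSqrtCoeff_succ, invSqrtCoeff_succ, ← mul_assoc]
    apply mul_le_mul ih _ (by positivity) (invSqrtCoeff_pos _).le
    rw [div_le_div_iff₀ (by positivity) (by positivity)]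
    push_cast
    nlinarith [(Nat.cast_nonneg i : (0 : ℝ) ≤ i)]

/-- The left-hand product is nonincreasing in `n`. With `4 * n + 1` in place of `2 * n + 1` it is
nondecreasing; together the two bounds pin the decay at `n^(-1/2)`. -/
theorem sq_invSqrtCoeff_le (n : ℕ) : invSqrtCoeff n ^ 2 * (2 * n + 1) ≤ 1 := by
  induction n with
  | zero => simp [invSqrtCoeff_zero]
  | succ n ih =>
    refine le_trans ?_ ih
    rw [invSqrtCoeff_succ, mul_pow, mul_assoc]
    gcongr
    rw [div_pow, div_mul_eq_mul_div, div_le_iff₀ (by positivity)]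
    push_cast
    nlinarith [(Nat.cast_nonneg n : (0 : ℝ) ≤ n)]

theorem le_sq_invSqrtCoeff (n : ℕ) : 1 ≤ invSqrtCoeff n ^ 2 * (4 * n + 1) := by
  induction n with
  | zero => simp [invSqrtCoeff_zero]
  | succ n ih =>
    refine le_trans ih ?_
    rw [invSqrtCoeff_succ, mul_pow, mul_assoc]
    refine mul_le_mul_of_nonneg_left ?_ (sq_nonneg _)
    rw [div_pow, div_mul_eq_mul_div, le_div_iff₀ (by positivity)]
    push_cast
    nlinarith [(Nat.cast_nonneg n : (0 : ℝ) ≤ n)]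

theorem invSqrtCoeff_le_four_mul {j n : ℕ} (h : n ≤ 2 * j + 2) :
    invSqrtCoeff j ≤ 4 * invSqrtCoeff n := by
  have h1 := sq_invSqrtCoeff_le j
  have h2 := le_sq_invSqrtCoeff n
  have hj := invSqrtCoeff_pos j
  have hn := invSqrtCoeff_pos n
  have h' : (n : ℝ) ≤ 2 * j + 2 := by exact_mod_cast h
  apply abs_le_of_sq_le_sq' _ (by positivity) |>.2
  have h3 : invSqrtCoeff j ^ 2 * (2 * j + 1) ≤ invSqrtCoeff n ^ 2 * (4 * n + 1) := h1.trans h2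
  have h4 : invSqrtCoeff n ^ 2 * (4 * n + 1) ≤ invSqrtCoeff n ^ 2 * (16 * (2 * j + 1)) := by
    refine mul_le_mul_of_nonneg_left ?_ (sq_nonneg _)
    have : (0 : ℝ) ≤ j := Nat.cast_nonneg j
    linarith
  have h5 : (0 : ℝ) < 2 * j + 1 := by positivity
  refine le_of_mul_le_mul_right ?_ h5
  linarith

theorem hasSum_invSqrtCoeff {u : ℝ} (hu : |u| < 1) :
    HasSum (fun n => invSqrtCoeff n * u ^ n) (1 / √(1 - u)) := by
  have h := (Real.one_div_one_sub_rpow_hasFPowerSeriesOnBall_zero (1 / 2)).hasSum (y := u)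
    (by
      rw [Metric.mem_eball, edist_zero_right, enorm_eq_nnnorm]
      exact_mod_cast hu)
  simp only [zero_add, FormalMultilinearSeries.ofScalars_apply_eq, ← Ring.multichoose_eq,
    smul_eq_mul] at h
  rw [Real.sqrt_eq_rpow]
  exact h

/-- The Taylor coefficients of `((1 - u) (1 + u / 3)) ^ (-1/2)` at `0`. -/
def curvatureCoeff (n : ℕ) : ℝ :=
  ∑ p ∈ Finset.HasAntidiagonal.antidiagonal n, invSqrtCoeff p.1 * (invSqrtCoeff p.2 * (-1 / 3) ^ p.2)

theorem hasSum_curvatureCoeff {u : ℝ} (hu : |u| < 1) :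
    HasSum (fun n => curvatureCoeff n * u ^ n) (1 / √(1 - u) * (1 / √(1 + u / 3))) := by
  have h1 := hasSum_invSqrtCoeff hu
  have hu3 : |-(u / 3)| < 1 := by
    rw [abs_neg, abs_div, abs_of_pos (by norm_num : (0 : ℝ) < 3)]; linarith
  have h2 := hasSum_invSqrtCoeff hu3
  have e : (fun n => curvatureCoeff n * u ^ n) = fun n => ∑ p ∈ Finset.HasAntidiagonal.antidiagonal n,
      (invSqrtCoeff p.1 * u ^ p.1) * (invSqrtCoeff p.2 * (-(u / 3)) ^ p.2) := by
    funext n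
    rw [curvatureCoeff, Finset.sum_mul]
    refine Finset.sum_congr rfl fun p hp => ?_
    rw [← Finset.HasAntidiagonal.mem_antidiagonal.1 hp, pow_add, show -(u / 3) = (-1 / 3) * u by ring, mul_pow]
    ring
  rw [sub_neg_eq_add] at h2
  rw [e, ← h1.tsum_eq, ← h2.tsum_eq,
    tsum_mul_tsum_eq_tsum_sum_antidiagonal_of_summable_norm h1.summable.norm h2.summable.norm]
  exact (summable_norm_sum_mul_antidiagonal_of_summable_norm h1.summable.norm
    h2.summable.norm).of_norm.hasSum

/-- The factor `(1 + u/3)^(-1/2)` is analytic past the unit disc and so changes the coefficients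
only by a constant factor. Concretely, the `k = 0` term of the convolution is `invSqrtCoeff n`, and
supermultiplicativity bounds the others by `invSqrtCoeff n * 3^(-k)`, with `∑_{k ≥ 1} 3^(-k) = 1/2`.
-/
theorem abs_curvatureCoeff_sub_le (n : ℕ) :
    |curvatureCoeff n - invSqrtCoeff n| ≤ invSqrtCoeff n / 2 := by
  have e : curvatureCoeff n = ∑ k ∈ Finset.range (n + 1),
      invSqrtCoeff (n - k) * (invSqrtCoeff k * (-1 / 3) ^ k) := by
    rw [curvatureCoeff, ← Finset.Nat.sum_antidiagonal_swap,
      Finset.Nat.sum_antidiagonal_eq_sum_range_succ_mk]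
    rfl
  rw [e, Finset.sum_range_succ']
  simp only [tsub_zero, invSqrtCoeff_zero, pow_zero, mul_one, add_sub_cancel_right]
  refine (Finset.abs_sum_le_sum_abs _ _).trans ?_
  have h1 : ∀ k ∈ Finset.range n,
      |invSqrtCoeff (n - (k + 1)) * (invSqrtCoeff (k + 1) * (-1 / 3) ^ (k + 1))|
        ≤ invSqrtCoeff n * ((1 / 3) * (1 / 3) ^ k) := by
    intro k hk
    have hk' : n - (k + 1) + (k + 1) = n := Nat.sub_add_cancel (Finset.mem_range.1 hk)
    have h2 := invSqrtCoeff_mul_le (n - (k + 1)) (k + 1)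
    rw [hk'] at h2
    rw [← mul_assoc, abs_mul, abs_pow, abs_of_pos (mul_pos (invSqrtCoeff_pos _)
      (invSqrtCoeff_pos _)), show |(-1 / 3 : ℝ)| = 1 / 3 by norm_num [abs_of_neg], pow_succ']
    gcongr
  refine (Finset.sum_le_sum h1).trans ?_
  rw [← Finset.mul_sum, ← Finset.mul_sum]
  have h3 : ∑ k ∈ Finset.range n, (1 / 3 : ℝ) ^ k ≤ 3 / 2 := by
    have := (hasSum_geometric_of_lt_one (r := (1 / 3 : ℝ)) (by norm_num) (by norm_num))
    refine (this.summable.sum_le_tsum _ (fun _ _ => by positivity)).trans ?_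
    rw [this.tsum_eq]; norm_num
  nlinarith [invSqrtCoeff_pos n]

theorem le_curvatureCoeff (n : ℕ) : invSqrtCoeff n / 2 ≤ curvatureCoeff n := by
  have := (abs_le.1 (abs_curvatureCoeff_sub_le n)).1
  linarith

theorem curvatureCoeff_le (n : ℕ) : curvatureCoeff n ≤ 3 / 2 * invSqrtCoeff n := by
  have := (abs_le.1 (abs_curvatureCoeff_sub_le n)).2
  linarith

theorem abs_curvatureCoeff_le (n : ℕ) : |curvatureCoeff n| ≤ 2 := by
  have h1 := le_curvatureCoeff n
  have h2 := curvatureCoeff_le n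
  have h3 := invSqrtCoeff_pos n
  have h4 := invSqrtCoeff_le_one n
  rw [abs_le]; constructor <;> linarith

/-! ### Convolution of a sequence with polynomial decay. -/

/-- A model sequence with the decay of the Taylor coefficients of the ReLU kernel. -/
def modelCoeff : ℕ → ℝ
  | 0 => 1
  | 1 => 1
  | n + 2 => invSqrtCoeff n / ((n + 1) * (n + 2))

theorem modelCoeff_pos (n : ℕ) : 0 < modelCoeff n := by
  match n with
  | 0 => simp [modelCoeff]
  | 1 => simp [modelCoeff]
  | n + 2 => have := invSqrtCoeff_pos n; simp only [modelCoeff]; positivity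

theorem summable_modelCoeff : Summable modelCoeff := by
  rw [← summable_nat_add_iff 2]
  refine Summable.of_nonneg_of_le (fun n => (modelCoeff_pos _).le) (fun n => ?_)
    ((summable_nat_add_iff 1).2 (Real.summable_one_div_nat_pow.2 (by norm_num : 1 < 2)))
  have h1 := invSqrtCoeff_le_one n
  have h0 := invSqrtCoeff_pos n
  simp only [modelCoeff]
  push_cast
  gcongr
  nlinarith [(Nat.cast_nonneg n : (0 : ℝ) ≤ n)]

/-- A doubling property, which polynomial decay has and geometric decay lacks. The factor is `4`
from `invSqrtCoeff` times `6` from the quadratic denominator. -/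
theorem modelCoeff_le_mul {j n : ℕ} (hn : n ≤ 2 * j) :
    modelCoeff j ≤ 24 * modelCoeff n := by
  match j, n with
  | 0, 0 => simp [modelCoeff]
  | 0, n + 1 => omega
  | 1, 0 => simp [modelCoeff]
  | 1, 1 => simp [modelCoeff]
  | 1, 2 => simp only [modelCoeff, invSqrtCoeff_zero]; norm_num
  | 1, n + 3 => omega
  | j + 2, 0 | j + 2, 1 =>
    have h1 := invSqrtCoeff_le_one j
    have h0 := invSqrtCoeff_pos j
    simp only [modelCoeff]
    rw [div_le_iff₀ (by positivity)]
    nlinarith [(Nat.cast_nonneg j : (0 : ℝ) ≤ j),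
      mul_nonneg (Nat.cast_nonneg j : (0 : ℝ) ≤ j) (Nat.cast_nonneg j : (0 : ℝ) ≤ j)]
  | j + 2, n + 2 =>
    have h0 := invSqrtCoeff_pos n
    have h1 := invSqrtCoeff_le_four_mul (j := j) (n := n) (by omega)
    have h2 : (n : ℝ) ≤ 2 * j + 2 := by exact_mod_cast (show n ≤ 2 * j + 2 by omega)
    have h3 : (0 : ℝ) ≤ j := Nat.cast_nonneg j
    simp only [modelCoeff]
    rw [← mul_div_assoc, div_le_div_iff₀ (by positivity) (by positivity)]
    have h4 : ((n : ℝ) + 1) * (n + 2) ≤ (2 * j + 3) * (2 * j + 4) := by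
      apply mul_le_mul <;> linarith
    have h5 : ((2 : ℝ) * j + 3) * (2 * j + 4) ≤ 6 * ((j + 1) * (j + 2)) := by nlinarith
    calc invSqrtCoeff j * ((n + 1) * (n + 2))
        ≤ (4 * invSqrtCoeff n) * (6 * ((j + 1) * (j + 2))) := by
          exact mul_le_mul h1 (h4.trans h5) (by positivity) (by positivity)
      _ = _ := by ring

/-- In each pair with sum `n` the larger index is at least `n / 2`, so doubling bounds its
coefficient by `24 * modelCoeff n`; the other index is summed freely. -/
theorem modelCoeff_conv_le : ∃ L : ℝ, 0 < L ∧ ∀ n,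
    ∑ p ∈ Finset.HasAntidiagonal.antidiagonal n, modelCoeff p.1 * modelCoeff p.2 ≤ L * modelCoeff n := by
  set S := ∑' n, modelCoeff n
  have hS : 0 < S := summable_modelCoeff.tsum_pos (fun n => (modelCoeff_pos n).le) 0
    (modelCoeff_pos 0)
  refine ⟨48 * S, by positivity, fun n => ?_⟩
  have h1 : ∀ p ∈ Finset.HasAntidiagonal.antidiagonal n, modelCoeff p.1 * modelCoeff p.2
      ≤ 24 * modelCoeff n * modelCoeff p.1 + 24 * modelCoeff n * modelCoeff p.2 := by
    intro p hp
    have hp' := Finset.HasAntidiagonal.mem_antidiagonal.1 hp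
    have a1 := modelCoeff_pos p.1
    have a2 := modelCoeff_pos p.2
    have a3 := modelCoeff_pos n
    rcases le_total p.1 p.2 with h | h
    · have := modelCoeff_le_mul (j := p.2) (n := n) (by omega)
      nlinarith [mul_pos a3 a2]
    · have := modelCoeff_le_mul (j := p.1) (n := n) (by omega)
      nlinarith [mul_pos a3 a1]
  refine (Finset.sum_le_sum h1).trans ?_
  have h3 : ∑ p ∈ Finset.HasAntidiagonal.antidiagonal n, modelCoeff p.1 ≤ S := by
    rw [Finset.Nat.sum_antidiagonal_eq_sum_range_succ_mk]
    exact summable_modelCoeff.sum_le_tsum _ fun _ _ => (modelCoeff_pos _).le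
  have h4 : ∑ p ∈ Finset.HasAntidiagonal.antidiagonal n, modelCoeff p.2 ≤ S := by
    rw [← Finset.Nat.sum_antidiagonal_swap]
    exact h3
  rw [Finset.sum_add_distrib, ← Finset.mul_sum, ← Finset.mul_sum]
  nlinarith [modelCoeff_pos n]

/-! ### Power series of the ReLU kernel. -/

/-- The arc-cosine kernel of degree one: `E[σ(X) σ(Y)]` for standard Gaussians with
correlation `t`. -/
def arcCosKernel (t : ℝ) : ℝ :=
  (√(1 - t ^ 2) + t * (Real.pi - Real.arccos t)) / (2 * Real.pi)

/-- The Taylor coefficients of `u ↦ arcCosKernel ((1 + u) / 2)` at `0`. -/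
def reluCoeff : ℕ → ℝ
  | 0 => arcCosKernel (1 / 2)
  | 1 => (Real.pi - Real.arccos (1 / 2)) / (4 * Real.pi)
  | n + 2 => curvatureCoeff n / ((n + 1) * (n + 2)) / (4 * Real.pi * √3)

/-- Termwise differentiation on a smaller interval `(-r, r)`, where the derivatives have a geometric
majorant. The shift `k` allows it to be applied twice. -/
theorem hasDerivAt_tsum_pow {f : ℕ → ℝ} {M : ℝ} (hf : ∀ n, |f n| ≤ M) (k : ℕ) {u : ℝ}
    (hu : |u| < 1) :
    HasDerivAt (fun v => ∑' n, f n / (n + k + 1) * v ^ (n + k + 1))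
      (∑' n, f n * u ^ (n + k)) u := by
  obtain ⟨r, hr, hr1⟩ := exists_between hu
  have hr0 : 0 ≤ r := (abs_nonneg u).trans hr.le
  have hM : 0 ≤ M := (abs_nonneg _).trans (hf 0)
  have hs : Summable fun n : ℕ => M * r ^ n :=
    (summable_geometric_of_lt_one hr0 hr1).mul_left M
  refine hasDerivAt_tsum_of_isPreconnected
    (g := fun n v => f n / (n + k + 1) * v ^ (n + k + 1)) (g' := fun n v => f n * v ^ (n + k)) (t := Set.Ioo (-r) r) (y₀ := 0) hs isOpen_Ioo
    isPreconnected_Ioo (fun n y _ => ?_) (fun n y hy => ?_) ?_ ?_ ?_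
  · refine ((hasDerivAt_pow (n + k + 1) y).const_mul (f n / (n + k + 1))).congr_deriv ?_
    have : (n + k + 1 : ℝ) ≠ 0 := by positivity
    rw [Nat.add_sub_cancel]
    push_cast
    field_simp
  · have hy' : |y| ≤ r := abs_le.2 ⟨hy.1.le, hy.2.le⟩
    rw [Real.norm_eq_abs, abs_mul, abs_pow]
    gcongr
    · exact hf n
    · calc |y| ^ (n + k) ≤ r ^ (n + k) := by gcongr
        _ ≤ r ^ n := pow_le_pow_of_le_one hr0 hr1.le (by omega)
  · have : 0 < r := lt_of_le_of_lt (abs_nonneg u) hr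
    exact ⟨by linarith, by linarith⟩
  · simp
  · exact abs_lt.1 hr

theorem hasDerivAt_arcCosKernel {t : ℝ} (h1 : -1 < t) (h2 : t < 1) :
    HasDerivAt arcCosKernel ((Real.pi - Real.arccos t) / (2 * Real.pi)) t := by
  have hpos : 0 < 1 - t ^ 2 := by nlinarith
  have d1 : HasDerivAt (fun t : ℝ => √(1 - t ^ 2)) (-(2 * t) / (2 * √(1 - t ^ 2))) t := by
    have : HasDerivAt (fun t : ℝ => 1 - t ^ 2) (-(2 * t)) t := by
      simpa using (hasDerivAt_pow 2 t).const_sub 1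
    exact this.sqrt hpos.ne'
  have d2 := (Real.hasDerivAt_arccos h1.ne' h2.ne).const_sub Real.pi
  have d3 := (d1.add ((hasDerivAt_id t).mul d2)).div_const (2 * Real.pi)
  refine d3.congr_deriv ?_
  have : √(1 - t ^ 2) ≠ 0 := (Real.sqrt_pos.2 hpos).ne'
  simp only [id]
  congr 1
  field_simp
  ring

/-- The second derivative of `arcCosKernel` is a multiple of `(1 - t²)^(-1/2)`. At `t = (1 + u)/2`
it factors into the two series multiplied in `curvatureCoeff`. -/
theorem curvature_eq {u : ℝ} (hu : |u| < 1) :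
    1 / √(1 - ((1 + u) / 2) ^ 2) = 2 / √3 * (1 / √(1 - u) * (1 / √(1 + u / 3))) := by
  have h := abs_lt.1 hu
  have e : 1 - ((1 + u) / 2) ^ 2 = (3 / 4) * ((1 - u) * (1 + u / 3)) := by ring
  rw [e, Real.sqrt_mul (by norm_num), Real.sqrt_mul (by linarith), Real.sqrt_div (by norm_num),
    show √(4 : ℝ) = 2 by rw [show (4 : ℝ) = 2 ^ 2 by norm_num]; simp]
  field_simp

/-- Both sides have the same second derivative, and their values and first derivatives vanish at
`0`; integrate twice. -/
theorem reluSeries_eq_of_abs_lt {u : ℝ} (hu : |u| < 1) :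
    ∑' n, curvatureCoeff n / ((n + 1) * (n + 2)) * u ^ (n + 2)
      = 4 * Real.pi * √3 * (arcCosKernel ((1 + u) / 2) - reluCoeff 0 - reluCoeff 1 * u) := by
  set c := 4 * Real.pi * √3
  have hc : 0 < c := by positivity
  have hI : ∀ v ∈ Set.Ioo (-1 : ℝ) 1, |v| < 1 := fun v hv => abs_lt.2 hv
  set S1 : ℝ → ℝ := fun v => ∑' n, curvatureCoeff n / (n + 0 + 1) * v ^ (n + 0 + 1)
  set S2 : ℝ → ℝ := fun v => ∑' n, (curvatureCoeff n / (n + 1)) / (n + 1 + 1) * v ^ (n + 1 + 1)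
  have dS1 : ∀ v, |v| < 1 → HasDerivAt S1 (1 / √(1 - v) * (1 / √(1 + v / 3))) v := by
    intro v hv
    have := hasDerivAt_tsum_pow abs_curvatureCoeff_le 0 hv
    simp only [add_zero, (hasSum_curvatureCoeff hv).tsum_eq] at this
    simpa [S1] using this
  have dS2 : ∀ v, |v| < 1 → HasDerivAt S2 (S1 v) v := by
    intro v hv
    have hb : ∀ n : ℕ, |curvatureCoeff n / (n + 1)| ≤ 2 := by
      intro n
      rw [abs_div, div_le_iff₀ (by positivity)]
      have h1 : (1 : ℝ) ≤ |(n : ℝ) + 1| := by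
        rw [abs_of_pos (by positivity)]; linarith [(Nat.cast_nonneg n : (0 : ℝ) ≤ n)]
      linarith [abs_curvatureCoeff_le n]
    have := hasDerivAt_tsum_pow hb 1 hv
    simpa [S1, S2] using this
  have dt : ∀ v : ℝ, HasDerivAt (fun v : ℝ => (1 + v) / 2) (1 / 2) v := fun v => by
    simpa using ((hasDerivAt_id v).const_add 1).div_const 2
  have ht : ∀ v : ℝ, |v| < 1 → -1 < (1 + v) / 2 ∧ (1 + v) / 2 < 1 := fun v hv => by
    have := abs_lt.1 hv; constructor <;> linarith
  set K1 : ℝ → ℝ := fun v => (Real.pi - Real.arccos ((1 + v) / 2)) / (4 * Real.pi)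
  set K : ℝ → ℝ := fun v => arcCosKernel ((1 + v) / 2)
  have dK : ∀ v, |v| < 1 → HasDerivAt K (K1 v) v := by
    intro v hv
    have := (hasDerivAt_arcCosKernel (ht v hv).1 (ht v hv).2).comp v (dt v)
    refine this.congr_deriv ?_
    simp only [K1]
    field_simp
    ring
  have dK1 : ∀ v, |v| < 1 → HasDerivAt K1 (1 / c * (1 / √(1 - v) * (1 / √(1 + v / 3)))) v := by
    intro v hv
    have h1 := ((Real.hasDerivAt_arccos (ht v hv).1.ne' (ht v hv).2.ne).comp v (dt v)).const_sub
      Real.pi |>.div_const (4 * Real.pi)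
    refine h1.congr_deriv ?_
    rw [curvature_eq hv]
    simp only [c]
    field_simp
  have hz : |(0 : ℝ)| < 1 := by simp
  have z1 : S1 0 = 0 := by simp [S1]
  have z2 : S2 0 = 0 := by simp [S2]
  have E1 : ∀ v, |v| < 1 → S1 v = c * (K1 v - K1 0) := by
    intro v hv
    have hd : ∀ w ∈ Set.Ioo (-1 : ℝ) 1, HasDerivAt (fun w => S1 w - c * (K1 w - K1 0)) 0 w := by
      intro w hw
      refine ((dS1 w (hI w hw)).sub
        (((dK1 w (hI w hw)).sub_const (K1 0)).const_mul c)).congr_deriv ?_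
      field_simp
      ring
    have := isOpen_Ioo.is_const_of_deriv_eq_zero isPreconnected_Ioo
      (fun w hw => (hd w hw).differentiableAt.differentiableWithinAt)
      (fun w hw => (hd w hw).deriv) (abs_lt.1 hv) (abs_lt.1 hz)
    simp only [z1] at this
    linarith
  have E2 : ∀ v, |v| < 1 → S2 v = c * (K v - K 0 - K1 0 * v) := by
    intro v hv
    have hd : ∀ w ∈ Set.Ioo (-1 : ℝ) 1,
        HasDerivAt (fun w => S2 w - c * (K w - K 0 - K1 0 * w)) 0 w := by
      intro w hw
      refine ((dS2 w (hI w hw)).sub ((((dK w (hI w hw)).sub_const (K 0)).sub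
        ((hasDerivAt_id w).const_mul (K1 0))).const_mul c)).congr_deriv ?_
      rw [E1 w (hI w hw)]
      ring
    have := isOpen_Ioo.is_const_of_deriv_eq_zero isPreconnected_Ioo
      (fun w hw => (hd w hw).differentiableAt.differentiableWithinAt)
      (fun w hw => (hd w hw).deriv) (abs_lt.1 hv) (abs_lt.1 hz)
    simp only [z2] at this
    linarith
  have := E2 u hu
  simp only [S2, K, K1, add_zero] at this
  rw [reluCoeff, reluCoeff, ← this]
  refine tsum_congr fun n => ?_
  rw [div_div, show (n : ℝ) + 1 + 1 = n + 2 by ring]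

theorem reluCoeff_bounds : ∃ c L : ℝ, 0 < c ∧ 0 < L ∧
    ∀ n, c * modelCoeff n ≤ reluCoeff n ∧ reluCoeff n ≤ L * modelCoeff n := by
  have h0 : 0 < reluCoeff 0 := by
    have : 0 ≤ Real.pi - Real.arccos (1 / 2) := sub_nonneg.2 (Real.arccos_le_pi _)
    have h2 : 0 < √(1 - (1 / 2 : ℝ) ^ 2) := Real.sqrt_pos.2 (by norm_num)
    simp only [reluCoeff, arcCosKernel]
    have := Real.pi_pos
    positivity
  have h1 : 0 < reluCoeff 1 := by
    have : 0 < Real.pi - Real.arccos (1 / 2) := by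
      have := Real.arccos_le_pi_div_two.2 (by norm_num : (0 : ℝ) ≤ 1 / 2)
      linarith [Real.pi_pos]
    simp only [reluCoeff]
    have := Real.pi_pos
    positivity
  set q := 4 * Real.pi * √3
  have hq : 0 < q := by positivity
  refine ⟨min (min (reluCoeff 0) (reluCoeff 1)) (1 / 2 / q),
    max (max (reluCoeff 0) (reluCoeff 1)) (3 / 2 / q), by positivity, by positivity, fun n => ?_⟩
  match n with
  | 0 => simp [modelCoeff]
  | 1 => simp [modelCoeff]
  | n + 2 =>
    have e : reluCoeff (n + 2) = (curvatureCoeff n / q) / ((n + 1) * (n + 2)) := by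
      simp only [reluCoeff]; ring
    have p := invSqrtCoeff_pos n
    rw [e]
    simp only [modelCoeff, ← mul_div_assoc]
    constructor
    · gcongr
      calc _ ≤ (1 / 2 / q) * invSqrtCoeff n := by gcongr; exact min_le_right _ _
        _ = (invSqrtCoeff n / 2) / q := by ring
        _ ≤ _ := by gcongr; exact le_curvatureCoeff n
    · gcongr
      calc _ ≤ (3 / 2 * invSqrtCoeff n) / q := by gcongr; exact curvatureCoeff_le n
        _ = (3 / 2 / q) * invSqrtCoeff n := by ring
        _ ≤ _ := by gcongr; exact le_max_right _ _

theorem reluCoeff_pos (n : ℕ) : 0 < reluCoeff n := by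
  obtain ⟨c, L, hc, -, h⟩ := reluCoeff_bounds
  exact (mul_pos hc (modelCoeff_pos n)).trans_le (h n).1

theorem summable_reluCoeff : Summable reluCoeff := by
  obtain ⟨c, L, -, -, h⟩ := reluCoeff_bounds
  exact .of_nonneg_of_le (fun n => (reluCoeff_pos n).le) (fun n => (h n).2)
    (summable_modelCoeff.mul_left L)

theorem reluCoeff_conv_le : ∃ L : ℝ, 0 < L ∧ ∀ n,
    ∑ p ∈ Finset.HasAntidiagonal.antidiagonal n, reluCoeff p.1 * reluCoeff p.2 ≤ L * reluCoeff n := by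
  obtain ⟨c, L, hc, hL, h⟩ := reluCoeff_bounds
  obtain ⟨L', hL', h'⟩ := modelCoeff_conv_le
  refine ⟨L * L * L' / c, by positivity, fun n => ?_⟩
  calc _ ≤ ∑ p ∈ Finset.HasAntidiagonal.antidiagonal n, (L * modelCoeff p.1) * (L * modelCoeff p.2) := by
        refine Finset.sum_le_sum fun p _ => ?_
        exact mul_le_mul (h _).2 (h _).2 (reluCoeff_pos _).le
          (mul_nonneg hL.le (modelCoeff_pos _).le)
    _ = L * L * ∑ p ∈ Finset.HasAntidiagonal.antidiagonal n, modelCoeff p.1 * modelCoeff p.2 := by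
        rw [Finset.mul_sum]
        exact Finset.sum_congr rfl fun p _ => by ring
    _ ≤ L * L * (L' * modelCoeff n) := by gcongr; exact h' n
    _ = L * L * L' / c * (c * modelCoeff n) := by field_simp
    _ ≤ _ := by gcongr; exact (h n).1

theorem summable_reluCoeff_mul_pow {u : ℝ} (hu : |u| ≤ 1) :
    Summable fun n => reluCoeff n * u ^ n := by
  refine Summable.of_norm_bounded summable_reluCoeff fun n => ?_
  rw [norm_mul, norm_pow, Real.norm_of_nonneg (reluCoeff_pos n).le]
  exact mul_le_of_le_one_right (reluCoeff_pos n).le (pow_le_one₀ (abs_nonneg u) hu)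

/-- The endpoints are needed, since `u = 1` is the diagonal of the kernel. They are reached by
continuity: summable coefficients make the series uniformly convergent on `[-1, 1]`. -/
theorem hasSum_reluCoeff {u : ℝ} (hu : |u| ≤ 1) :
    HasSum (fun n => reluCoeff n * u ^ n) (arcCosKernel ((1 + u) / 2)) := by
  have key : ∀ v ∈ Set.Ioo (-1 : ℝ) 1,
      ∑' n, reluCoeff n * v ^ n = arcCosKernel ((1 + v) / 2) := by
    intro v hv
    have hv' : |v| < 1 := abs_lt.2 hv
    rw [← (summable_reluCoeff_mul_pow hv'.le).sum_add_tsum_nat_add 2]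
    have h := reluSeries_eq_of_abs_lt hv'
    have : ∑' n, reluCoeff (n + 2) * v ^ (n + 2) = (1 / (4 * Real.pi * √3)) *
        ∑' n, curvatureCoeff n / ((n + 1) * (n + 2)) * v ^ (n + 2) := by
      rw [← tsum_mul_left]
      refine tsum_congr fun n => ?_
      simp only [reluCoeff]
      ring
    rw [this, h]
    have : (4 * Real.pi * √3) ≠ 0 := by positivity
    simp [Finset.sum_range_succ]
    field_simp
    ring
  have cont : ContinuousOn (fun v : ℝ => ∑' n, reluCoeff n * v ^ n) (Set.Icc (-1) 1) := by
    refine continuousOn_tsum (fun n => by fun_prop) summable_reluCoeff fun n v hv => ?_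
    rw [norm_mul, norm_pow, Real.norm_of_nonneg (reluCoeff_pos n).le]
    exact mul_le_of_le_one_right (reluCoeff_pos n).le (pow_le_one₀ (abs_nonneg v) (abs_le.2 hv))
  have cont' : ContinuousOn (fun v : ℝ => arcCosKernel ((1 + v) / 2)) (Set.Icc (-1) 1) := by
    have := Real.continuous_arccos
    unfold arcCosKernel
    fun_prop
  have := Set.EqOn.of_subset_closure key cont cont' Set.Ioo_subset_Icc_self
    (by rw [closure_Ioo (by norm_num)])
  rw [← show _ = arcCosKernel ((1 + u) / 2) from this (abs_le.1 hu)]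
  exact (summable_reluCoeff_mul_pow hu).hasSum

/-! ### Linear functionals of a standard Gaussian vector. -/

/-- The standard Gaussian law on `N → ℝ`. -/
abbrev stdLaw (N : Type*) [Fintype N] : Measure (N → ℝ) := Measure.pi fun _ => gaussianReal 0 1

section GaussianMarginals

variable {N : Type*} [Fintype N]

theorem integral_cexp_dotProduct (p : N → ℝ) :
    ∫ w, Complex.exp ((w ⬝ᵥ p : ℝ) * Complex.I) ∂(stdLaw N)
      = Complex.exp (-((p ⬝ᵥ p : ℝ) : ℂ) / 2) := by
  have h := charFun_pi (μ := fun _ : N => gaussianReal 0 1) (WithLp.toLp 2 p)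
  rw [charFun_apply, integral_map (by fun_prop) (by fun_prop)] at h
  simp only [PiLp.inner_apply, charFun_gaussianReal] at h
  convert h using 1
  · simp [dotProduct, mul_comm]
  · rw [← Complex.exp_sum]
    congr 1
    simp [dotProduct, Finset.sum_div, neg_div, sq]

theorem map_dotProduct_stdLaw (p : N → ℝ) :
    (stdLaw N).map (fun w => w ⬝ᵥ p) = gaussianReal 0 (p ⬝ᵥ p).toNNReal := by
  have hm : Measurable fun w : N → ℝ => w ⬝ᵥ p := by unfold dotProduct; fun_prop
  have : IsProbabilityMeasure ((stdLaw N).map (fun w => w ⬝ᵥ p)) :=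
    Measure.isProbabilityMeasure_map hm.aemeasurable
  apply Measure.ext_of_charFun
  funext t
  have hp : 0 ≤ p ⬝ᵥ p := by
    simpa using dotProduct_star_self_nonneg p
  rw [charFun_gaussianReal, charFun_apply, integral_map hm.aemeasurable (by fun_prop)]
  have := integral_cexp_dotProduct (t • p)
  simp only [dotProduct_smul, smul_dotProduct, smul_eq_mul] at this
  convert this using 2
  · funext w; simp
  · rw [Real.coe_toNNReal _ hp]
    push_cast
    ring

/-- The joint law of two linear functionals of a standard Gaussian vector depends only on their
Gram matrix. -/
theorem map_pair_stdLaw_congr {N' : Type*} [Fintype N'] {p q : N → ℝ} {p' q' : N' → ℝ}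
    (hpp : p ⬝ᵥ p = p' ⬝ᵥ p') (hpq : p ⬝ᵥ q = p' ⬝ᵥ q') (hqq : q ⬝ᵥ q = q' ⬝ᵥ q') :
    (stdLaw N).map (fun w => (w ⬝ᵥ p, w ⬝ᵥ q)) =
      (stdLaw N').map (fun w => (w ⬝ᵥ p', w ⬝ᵥ q')) := by
  have hm : ∀ {N : Type _} [Fintype N] (p q : N → ℝ),
      Measurable fun w : N → ℝ => (w ⬝ᵥ p, w ⬝ᵥ q) := by
    intro N _ p q; unfold dotProduct; fun_prop
  have hm' : ∀ {N' : Type _} [Fintype N'] (p q : N' → ℝ),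
      Measurable fun w : N' → ℝ => (w ⬝ᵥ p, w ⬝ᵥ q) := by
    intro N _ p q; unfold dotProduct; fun_prop
  have : IsProbabilityMeasure ((stdLaw N).map (fun w => (w ⬝ᵥ p, w ⬝ᵥ q))) :=
    Measure.isProbabilityMeasure_map (hm _ _).aemeasurable
  have : IsProbabilityMeasure ((stdLaw N').map (fun w => (w ⬝ᵥ p', w ⬝ᵥ q'))) :=
    Measure.isProbabilityMeasure_map (hm' _ _).aemeasurable
  refine (MeasurableEquiv.toLp 2 (ℝ × ℝ)).map_measurableEquiv_injective
    (Measure.ext_of_charFun (funext fun t => ?_))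
  rw [Measure.map_map (by fun_prop) (hm _ _), Measure.map_map (by fun_prop) (hm' _ _),
    charFun_apply, charFun_apply, integral_map (by fun_prop) (by fun_prop),
    integral_map (by fun_prop) (by fun_prop)]
  have h1 := integral_cexp_dotProduct (t.fst • p + t.snd • q)
  have h2 := integral_cexp_dotProduct (t.fst • p' + t.snd • q')
  have e : (t.fst • p + t.snd • q) ⬝ᵥ (t.fst • p + t.snd • q)
      = (t.fst • p' + t.snd • q') ⬝ᵥ (t.fst • p' + t.snd • q') := by
    simp only [dotProduct_add, add_dotProduct, dotProduct_smul, smul_dotProduct, smul_eq_mul,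
      hpp, hpq, hqq, dotProduct_comm q p, dotProduct_comm q' p']
  rw [e, ← h2] at h1
  convert h1 using 2
  · funext w
    simp [WithLp.prod_inner_apply, dotProduct_add, dotProduct_smul]
  · funext w
    simp [WithLp.prod_inner_apply, dotProduct_add, dotProduct_smul]

end GaussianMarginals

/-! ### The Gaussian integral behind the arc-cosine kernel. -/

theorem integral_prod_gaussianReal (G : ℝ × ℝ → ℝ) :
    ∫ z, G z ∂((gaussianReal 0 1).prod (gaussianReal 0 1))
      = ∫ z : ℝ × ℝ, (2 * Real.pi)⁻¹ * Real.exp (-(z.1 ^ 2 + z.2 ^ 2) / 2) * G z := by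
  rw [gaussianReal_of_var_ne_zero 0 one_ne_zero, prod_withDensity (by fun_prop) (by fun_prop),
    integral_withDensity_eq_integral_toReal_smul (by fun_prop)
      (.of_forall fun z => ENNReal.mul_lt_top gaussianPDF_lt_top gaussianPDF_lt_top)]
  congr 1
  funext z
  rw [ENNReal.toReal_mul, toReal_gaussianPDF, toReal_gaussianPDF]
  simp only [gaussianPDFReal_def, smul_eq_mul, NNReal.coe_one, mul_one, sub_zero]
  congr 1
  rw [mul_mul_mul_comm, ← Real.exp_add, ← mul_inv, Real.mul_self_sqrt (by positivity)]
  congr 2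
  ring

theorem integral_cube_mul_exp : ∫ r in Set.Ioi (0 : ℝ), r ^ 3 * Real.exp (-r ^ 2 / 2) = 2 := by
  have h := integral_rpow_mul_exp_neg_mul_rpow (p := 2) (q := 3) (b := 1 / 2) (by norm_num)
    (by norm_num) (by norm_num)
  have e : ((3 : ℝ) + 1) / 2 = 1 + 1 := by norm_num
  rw [neg_div, e, Real.Gamma_add_one one_ne_zero, Real.Gamma_one] at h
  norm_num at h
  refine Eq.trans ?_ h
  congr 1
  funext r
  congr 2
  ring

/-- Both cosines are nonnegative on `(φ - π/2, π/2]`, where the ReLUs may be dropped; elsewhere at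
least one factor vanishes. -/
theorem integral_relu_cos {φ : ℝ} (h0 : 0 ≤ φ) (h1 : φ ≤ Real.pi) :
    ∫ θ in Set.Ioo (-Real.pi) Real.pi, relu (Real.cos θ) * relu (Real.cos (θ - φ))
      = (Real.sin φ + Real.cos φ * (Real.pi - φ)) / 2 := by
  have hpi := Real.pi_pos
  have hsub : Set.Ioc (φ - Real.pi / 2) (Real.pi / 2) ⊆ Set.Ioo (-Real.pi) Real.pi := by
    intro θ hθ
    constructor <;> linarith [hθ.1, hθ.2]
  rw [setIntegral_eq_of_subset_of_forall_sdiff_eq_zero measurableSet_Ioo hsub]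
  · have e : ∫ θ in Set.Ioc (φ - Real.pi / 2) (Real.pi / 2),
        relu (Real.cos θ) * relu (Real.cos (θ - φ))
        = ∫ θ in Set.Ioc (φ - Real.pi / 2) (Real.pi / 2),
          Real.cos θ * Real.cos (θ - φ) := by
      refine setIntegral_congr_fun measurableSet_Ioc fun θ hθ => ?_
      have c1 : 0 ≤ Real.cos θ := Real.cos_nonneg_of_mem_Icc ⟨by linarith [hθ.1], hθ.2⟩
      have c2 : 0 ≤ Real.cos (θ - φ) :=
        Real.cos_nonneg_of_mem_Icc ⟨by linarith [hθ.1], by linarith [hθ.2]⟩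
      simp only [relu, max_eq_left c1, max_eq_left c2]
    rw [e, ← intervalIntegral.integral_of_le (by linarith)]
    have hd : ∀ θ ∈ Set.uIcc (φ - Real.pi / 2) (Real.pi / 2),
        HasDerivAt (fun θ => Real.sin (2 * θ - φ) / 4 + θ * Real.cos φ / 2)
          (Real.cos θ * Real.cos (θ - φ)) θ := by
      intro θ _
      have d1 : HasDerivAt (fun θ : ℝ => 2 * θ - φ) 2 θ := by
        simpa using ((hasDerivAt_id θ).const_mul 2).sub_const φ
      have d2 := (d1.sin.div_const 4).add
        (((hasDerivAt_id θ).mul_const (Real.cos φ)).div_const 2)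
      refine d2.congr_deriv ?_
      rw [show 2 * θ - φ = θ + (θ - φ) by ring, Real.cos_add]
      have : Real.cos φ = Real.cos θ * Real.cos (θ - φ) + Real.sin θ * Real.sin (θ - φ) := by
        rw [← Real.cos_sub]; congr 1; ring
      rw [this]
      ring
    rw [intervalIntegral.integral_eq_sub_of_hasDerivAt hd
      (Continuous.intervalIntegrable (by fun_prop) _ _)]
    rw [show 2 * (Real.pi / 2) - φ = Real.pi - φ by ring,
      show 2 * (φ - Real.pi / 2) - φ = φ - Real.pi by ring, Real.sin_pi_sub, Real.sin_sub_pi]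
    ring
  · intro θ hθ
    have h2 := hθ.1
    have h3 := hθ.2
    rw [Set.mem_Ioc, not_and_or, not_lt, not_le] at h3
    have key : Real.cos θ ≤ 0 ∨ Real.cos (θ - φ) ≤ 0 := by
      rcases h3 with h3 | h3
      · rcases le_total θ (-(Real.pi / 2)) with h4 | h4
        · left
          rw [← Real.cos_neg]
          exact Real.cos_nonpos_of_pi_div_two_le_of_le (by linarith) (by linarith [h2.1])
        · right
          rw [← Real.cos_neg]
          exact Real.cos_nonpos_of_pi_div_two_le_of_le (by linarith) (by linarith)
      · left
        exact Real.cos_nonpos_of_pi_div_two_le_of_le h3.le (by linarith [h2.2])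
    rcases key with h | h
    · simp [relu, max_eq_right h]
    · simp [relu, max_eq_right h]

theorem relu_mul_of_nonneg {r : ℝ} (hr : 0 ≤ r) (t : ℝ) : relu (r * t) = r * relu t := by
  simp [relu, mul_max_of_nonneg _ _ hr]

@[fun_prop]
theorem continuous_relu : Continuous relu := by unfold relu; fun_prop

/-- ReLU is positively homogeneous, so in polar coordinates the integral splits into a radial moment
and the angular integral. -/
theorem integral_relu_mul_relu_prod {φ : ℝ} (h0 : 0 ≤ φ) (h1 : φ ≤ Real.pi) :
    ∫ z, relu z.1 * relu (z.1 * Real.cos φ + z.2 * Real.sin φ)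
        ∂((gaussianReal 0 1).prod (gaussianReal 0 1)) = arcCosKernel (Real.cos φ) := by
  rw [integral_prod_gaussianReal, ← integral_comp_polarCoord_symm, polarCoord_target]
  have e : ∀ p ∈ Set.Ioi (0 : ℝ) ×ˢ Set.Ioo (-Real.pi) Real.pi,
      p.1 • ((2 * Real.pi)⁻¹ * Real.exp (-((polarCoord.symm p).1 ^ 2 +
        (polarCoord.symm p).2 ^ 2) / 2) * (relu (polarCoord.symm p).1 *
          relu ((polarCoord.symm p).1 * Real.cos φ + (polarCoord.symm p).2 * Real.sin φ)))
      = (p.1 ^ 3 * Real.exp (-p.1 ^ 2 / 2)) *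
        ((2 * Real.pi)⁻¹ * (relu (Real.cos p.2) * relu (Real.cos (p.2 - φ)))) := by
    intro p hp
    have hr : 0 ≤ p.1 := (Set.mem_Ioi.1 hp.1).le
    have e1 : p.1 * Real.cos p.2 * Real.cos φ + p.1 * Real.sin p.2 * Real.sin φ
        = p.1 * Real.cos (p.2 - φ) := by rw [Real.cos_sub]; ring
    have e2 : (p.1 * Real.cos p.2) ^ 2 + (p.1 * Real.sin p.2) ^ 2 = p.1 ^ 2 := by
      rw [mul_pow, mul_pow, ← mul_add, Real.cos_sq_add_sin_sq, mul_one]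
    simp only [polarCoord_symm_apply, e1, e2, relu_mul_of_nonneg hr, smul_eq_mul]
    ring
  rw [setIntegral_congr_fun (measurableSet_Ioi.prod measurableSet_Ioo) e,
    Measure.volume_eq_prod, setIntegral_prod_mul (fun r : ℝ => r ^ 3 * Real.exp (-r ^ 2 / 2))
      (fun θ : ℝ => (2 * Real.pi)⁻¹ * (relu (Real.cos θ) * relu (Real.cos (θ - φ)))),
    integral_cube_mul_exp, integral_const_mul, integral_relu_cos h0 h1, arcCosKernel,
    Real.arccos_cos h0 h1, ← Real.sin_sq, Real.sqrt_sq (Real.sin_nonneg_of_nonneg_of_le_pi h0 h1)]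
  field_simp

/-- Only the Gram matrix of `p, q` matters, so they may be replaced by unit vectors of the plane at
angle `φ`. -/
theorem integral_relu_mul_relu {N : Type*} [Fintype N] {p q : N → ℝ} (hp : p ⬝ᵥ p = 1)
    (hq : q ⬝ᵥ q = 1) :
    ∫ w, relu (w ⬝ᵥ p) * relu (w ⬝ᵥ q) ∂(stdLaw N) = arcCosKernel (p ⬝ᵥ q) := by
  have hcs : |p ⬝ᵥ q| ≤ 1 := by
    have h1 : 0 ≤ (p + q) ⬝ᵥ (p + q) := by simpa using dotProduct_star_self_nonneg (p + q)
    have h2 : 0 ≤ (p - q) ⬝ᵥ (p - q) := by simpa using dotProduct_star_self_nonneg (p - q)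
    simp only [dotProduct_add, add_dotProduct, dotProduct_sub, sub_dotProduct,
      dotProduct_comm q p, hp, hq] at h1 h2
    rw [abs_le]
    constructor <;> linarith
  set φ := Real.arccos (p ⬝ᵥ q)
  have hφ : Real.cos φ = p ⬝ᵥ q := Real.cos_arccos (abs_le.1 hcs).1 (abs_le.1 hcs).2
  have hm : ∀ {N : Type _} [Fintype N] (p q : N → ℝ),
      Measurable fun w : N → ℝ => (w ⬝ᵥ p, w ⬝ᵥ q) := by
    intro N _ p q; unfold dotProduct; fun_prop
  have hm2 : ∀ (p q : Fin 2 → ℝ),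
      Measurable fun w : Fin 2 → ℝ => (w ⬝ᵥ p, w ⬝ᵥ q) := by
    intro p q; unfold dotProduct; fun_prop
  have key := map_pair_stdLaw_congr (p := p) (q := q) (p' := ![1, 0])
    (q' := ![Real.cos φ, Real.sin φ]) (by simp [hp]) (by simp [hφ])
    (by simp [hq, ← sq])
  have hG : Continuous fun z : ℝ × ℝ => relu z.1 * relu z.2 := by fun_prop
  have h1 := integral_map (hm p q).aemeasurable (μ := stdLaw N) (f := fun z => relu z.1 * relu z.2)
    hG.aestronglyMeasurable
  have h2 := integral_map (hm2 ![1, 0] ![Real.cos φ, Real.sin φ]).aemeasurable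
    (μ := stdLaw (Fin 2)) (f := fun z => relu z.1 * relu z.2) hG.aestronglyMeasurable
  rw [← h1, key, h2, ← hφ,
    ← integral_relu_mul_relu_prod (Real.arccos_nonneg _) (Real.arccos_le_pi _),
    ← (measurePreserving_piFinTwo fun _ => gaussianReal 0 1).integral_comp
      (MeasurableEquiv.piFinTwo _).measurableEmbedding]
  simp [dotProduct, Fin.sum_univ_two]
  rfl

/-! ### The reproducing kernel Hilbert space of the ReLU layer. -/

section ReluKernel

variable {d : ℕ}

instance : IsProbabilityMeasure (unitLaw d) := by unfold unitLaw; infer_instance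

theorem augment_dotProduct_augment (x y : EuclideanSpace ℝ (Fin d)) :
    augment x ⬝ᵥ augment y = (1 + inner ℝ x y) / 2 := by
  simp only [dotProduct, augment, Fin.sum_univ_castSucc, Fin.snoc_castSucc, Fin.snoc_last,
    PiLp.inner_apply, RCLike.inner_apply, conj_trivial]
  have h : √(2 : ℝ) * √2 = 2 := Real.mul_self_sqrt (by norm_num)
  have h2 : ∀ i, x i / √2 * (y i / √2) = (y i * x i) / 2 := by
    intro i; rw [div_mul_div_comm, h, mul_comm]
  simp only [h2, div_mul_div_comm, h, ← Finset.sum_div]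
  ring

theorem augment_dotProduct_self {x : EuclideanSpace ℝ (Fin d)} (hx : ‖x‖ = 1) :
    augment x ⬝ᵥ augment x = 1 := by
  rw [augment_dotProduct_augment, real_inner_self_eq_norm_sq, hx]; norm_num

/-- The feature `σ(⟨w, x'⟩)` of the ReLU layer. -/
def reluFeature (x : EuclideanSpace ℝ (Fin d)) (w : Fin (d + 1) → ℝ) : ℝ :=
  relu (w ⬝ᵥ augment x)

theorem abs_relu_le (t : ℝ) : |relu t| ≤ |t| := by
  unfold relu
  rw [abs_of_nonneg (le_max_right _ _)]
  exact max_le (le_abs_self t) (abs_nonneg t)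

theorem memLp_coord (i : Fin (d + 1)) {r : ℝ≥0∞} (hr : r ≠ ∞) :
    MemLp (fun w : Fin (d + 1) → ℝ => w i) r (unitLaw d) :=
  (memLp_id_gaussianReal' r hr).comp_measurePreserving
    (measurePreserving_eval (fun _ : Fin (d + 1) => gaussianReal 0 1) i)

theorem continuous_reluFeature (x : EuclideanSpace ℝ (Fin d)) : Continuous (reluFeature x) := by
  unfold reluFeature dotProduct
  fun_prop

theorem memLp_reluFeature (x : EuclideanSpace ℝ (Fin d)) {r : ℝ≥0∞} (hr : r ≠ ∞) :
    MemLp (reluFeature x) r (unitLaw d) := by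
  have h : MemLp (fun w : Fin (d + 1) → ℝ => w ⬝ᵥ augment x) r (unitLaw d) := by
    unfold dotProduct
    exact memLp_finsetSum _ fun i _ => (memLp_coord i hr).mul_const (augment x i)
  exact h.mono (continuous_reluFeature x).aestronglyMeasurable
    (.of_forall fun w => abs_relu_le _)

theorem integrable_reluFeature_mul (x y : EuclideanSpace ℝ (Fin d)) :
    Integrable (fun w => reluFeature x w * reluFeature y w) (unitLaw d) :=
  (memLp_reluFeature x ENNReal.ofNat_ne_top).integrable_mul
    (memLp_reluFeature y ENNReal.ofNat_ne_top) (p := 2) (q := 2)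

/-- The kernel of the infinitely wide ReLU layer. -/
def reluKernel (x y : EuclideanSpace ℝ (Fin d)) : ℝ :=
  ∫ w, reluFeature x w * reluFeature y w ∂(unitLaw d)

theorem abs_inner_le_one {x y : EuclideanSpace ℝ (Fin d)} (hx : ‖x‖ = 1) (hy : ‖y‖ = 1) :
    |inner ℝ x y| ≤ 1 := by
  simpa [hx, hy] using abs_real_inner_le_norm x y

theorem hasSum_reluKernel {x y : EuclideanSpace ℝ (Fin d)} (hx : ‖x‖ = 1) (hy : ‖y‖ = 1) :
    HasSum (fun n => reluCoeff n * inner ℝ x y ^ n) (reluKernel x y) := by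
  have h := integral_relu_mul_relu (augment_dotProduct_self hx) (augment_dotProduct_self hy)
  rw [augment_dotProduct_augment] at h
  rw [show reluKernel x y = _ from h]
  exact hasSum_reluCoeff (abs_inner_le_one hx hy)

theorem hasSum_reluKernel_sq {x y : EuclideanSpace ℝ (Fin d)} (hx : ‖x‖ = 1) (hy : ‖y‖ = 1) :
    HasSum (fun n => (∑ p ∈ Finset.HasAntidiagonal.antidiagonal n,
      reluCoeff p.1 * reluCoeff p.2) * inner ℝ x y ^ n) (reluKernel x y ^ 2) := by
  have h := hasSum_reluKernel hx hy
  have e : (fun n => (∑ p ∈ Finset.HasAntidiagonal.antidiagonal n,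
      reluCoeff p.1 * reluCoeff p.2) * inner ℝ x y ^ n) =
      fun n => ∑ p ∈ Finset.HasAntidiagonal.antidiagonal n,
        (reluCoeff p.1 * inner ℝ x y ^ p.1) * (reluCoeff p.2 * inner ℝ x y ^ p.2) := by
    funext n
    rw [Finset.sum_mul]
    refine Finset.sum_congr rfl fun p hp => ?_
    rw [← Finset.HasAntidiagonal.mem_antidiagonal.1 hp, pow_add]
    ring
  rw [e, sq, ← h.tsum_eq,
    tsum_mul_tsum_eq_tsum_sum_antidiagonal_of_summable_norm h.summable.norm h.summable.norm]
  exact (summable_norm_sum_mul_antidiagonal_of_summable_norm h.summable.norm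
    h.summable.norm).of_norm.hasSum

/-- The `n`-th power of the inner product is the inner product of `n`-th tensor powers, so the form
is a sum of squares over multi-indices. -/
theorem sum_sum_inner_pow_nonneg (S : Finset (EuclideanSpace ℝ (Fin d)))
    (c : EuclideanSpace ℝ (Fin d) → ℝ) (n : ℕ) :
    0 ≤ ∑ x ∈ S, ∑ y ∈ S, c x * c y * inner ℝ x y ^ n := by
  have e : ∑ x ∈ S, ∑ y ∈ S, c x * c y * inner ℝ x y ^ n
      = ∑ α : Fin n → Fin d, (∑ x ∈ S, c x * ∏ i, x (α i)) ^ 2 := by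
    simp only [sq, Finset.sum_mul_sum]
    symm
    rw [Finset.sum_comm]
    refine Finset.sum_congr rfl fun x _ => ?_
    rw [Finset.sum_comm]
    refine Finset.sum_congr rfl fun y _ => ?_
    symm
    simp only [PiLp.inner_apply, RCLike.inner_apply, conj_trivial]
    rw [Fintype.sum_pow, Finset.mul_sum]
    refine Finset.sum_congr rfl fun α _ => ?_
    rw [Finset.prod_mul_distrib]
    ring
  rw [e]
  positivity

/-- The squared norm of `∑ c x • σ(⟨·, x'⟩)` in `L²`. -/
def reluEnergy (S : Finset (EuclideanSpace ℝ (Fin d))) (c : EuclideanSpace ℝ (Fin d) → ℝ) : ℝ :=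
  ∫ w, (∑ x ∈ S, c x * reluFeature x w) ^ 2 ∂(unitLaw d)

theorem memLp_sum_reluFeature (S : Finset (EuclideanSpace ℝ (Fin d)))
    (c : EuclideanSpace ℝ (Fin d) → ℝ) :
    MemLp (fun w => ∑ x ∈ S, c x * reluFeature x w) 2 (unitLaw d) :=
  memLp_finsetSum _ fun x _ => (memLp_reluFeature x ENNReal.ofNat_ne_top).const_mul (c x)

theorem reluEnergy_nonneg (S : Finset (EuclideanSpace ℝ (Fin d)))
    (c : EuclideanSpace ℝ (Fin d) → ℝ) : 0 ≤ reluEnergy S c :=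
  integral_nonneg fun _ => sq_nonneg _

theorem reluEnergy_eq (S : Finset (EuclideanSpace ℝ (Fin d)))
    (c : EuclideanSpace ℝ (Fin d) → ℝ) :
    reluEnergy S c = ∑ x ∈ S, ∑ y ∈ S, c x * c y * reluKernel x y := by
  unfold reluEnergy
  simp only [sq, Finset.sum_mul_sum]
  have hi : ∀ x y : EuclideanSpace ℝ (Fin d),
      Integrable (fun w => c x * reluFeature x w * (c y * reluFeature y w)) (unitLaw d) := by
    intro x y
    have := (integrable_reluFeature_mul x y).const_mul (c x * c y)
    refine this.congr (.of_forall fun w => ?_)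
    simp only
    ring
  rw [integral_finsetSum _ fun x _ => integrable_finsetSum _ fun y _ => hi x y]
  refine Finset.sum_congr rfl fun x _ => ?_
  rw [integral_finsetSum _ fun y _ => hi x y]
  refine Finset.sum_congr rfl fun y _ => ?_
  rw [reluKernel, ← integral_const_mul]
  congr 1
  funext w
  ring

theorem hasSum_reluEnergy {S : Finset (EuclideanSpace ℝ (Fin d))} (hS : ∀ x ∈ S, ‖x‖ = 1)
    (c : EuclideanSpace ℝ (Fin d) → ℝ) :
    HasSum (fun n => reluCoeff n * ∑ x ∈ S, ∑ y ∈ S, c x * c y * inner ℝ x y ^ n)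
      (reluEnergy S c) := by
  rw [reluEnergy_eq]
  have : HasSum (fun n => ∑ x ∈ S, ∑ y ∈ S, c x * c y * (reluCoeff n * inner ℝ x y ^ n))
      (∑ x ∈ S, ∑ y ∈ S, c x * c y * reluKernel x y) :=
    hasSum_sum fun x hx => hasSum_sum fun y hy =>
      (hasSum_reluKernel (hS x hx) (hS y hy)).mul_left (c x * c y)
  convert this using 2
  simp only [Finset.mul_sum]
  exact Finset.sum_congr rfl fun x _ => Finset.sum_congr rfl fun y _ => by ring

/-- `h` has norm at most `R` in the reproducing kernel Hilbert space of the ReLU kernel on the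
unit sphere, phrased through finite linear combinations of point evaluations. -/
def ReluBound (h : EuclideanSpace ℝ (Fin d) → ℝ) (R : ℝ) : Prop :=
  ∀ (S : Finset (EuclideanSpace ℝ (Fin d))) (c : EuclideanSpace ℝ (Fin d) → ℝ),
    (∀ x ∈ S, ‖x‖ = 1) → (∑ x ∈ S, c x * h x) ^ 2 ≤ R ^ 2 * reluEnergy S c

theorem ReluBound.mono {h : EuclideanSpace ℝ (Fin d) → ℝ} {R R' : ℝ} (hh : ReluBound h R)
    (h0 : 0 ≤ R) (hR : R ≤ R') : ReluBound h R' := fun S c hS =>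
  (hh S c hS).trans (mul_le_mul_of_nonneg_right (by gcongr) (reluEnergy_nonneg S c))

theorem ReluBound.add {h h' : EuclideanSpace ℝ (Fin d) → ℝ} {R R' : ℝ} (hh : ReluBound h R)
    (hh' : ReluBound h' R') (h0 : 0 ≤ R) (h0' : 0 ≤ R') :
    ReluBound (fun x => h x + h' x) (R + R') := by
  intro S c hS
  have e0 := reluEnergy_nonneg S c
  have h1 := abs_le_of_sq_le_sq (a := ∑ x ∈ S, c x * h x) (b := R * √(reluEnergy S c))
    (by rw [mul_pow, Real.sq_sqrt e0]; exact hh S c hS) (by positivity)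
  have h2 := abs_le_of_sq_le_sq (a := ∑ x ∈ S, c x * h' x) (b := R' * √(reluEnergy S c))
    (by rw [mul_pow, Real.sq_sqrt e0]; exact hh' S c hS) (by positivity)
  simp only [mul_add, Finset.sum_add_distrib]
  rw [← Real.sq_sqrt e0, ← mul_pow, add_mul]
  exact sq_le_sq' (by linarith [(abs_le.1 h1).1, (abs_le.1 h2).1])
    (by linarith [(abs_le.1 h1).2, (abs_le.1 h2).2])

theorem ReluBound.const_mul {h : EuclideanSpace ℝ (Fin d) → ℝ} {R : ℝ} (hh : ReluBound h R)
    (a : ℝ) : ReluBound (fun x => a * h x) (|a| * R) := by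
  intro S c hS
  have e : ∑ x ∈ S, c x * (a * h x) = a * ∑ x ∈ S, c x * h x := by
    rw [Finset.mul_sum]; exact Finset.sum_congr rfl fun x _ => by ring
  rw [e, mul_pow, mul_pow, sq_abs, mul_assoc]
  exact mul_le_mul_of_nonneg_left (hh S c hS) (sq_nonneg a)

theorem ReluBound.sum {ι : Type*} (s : Finset ι) {h : ι → EuclideanSpace ℝ (Fin d) → ℝ}
    {R : ι → ℝ} (hh : ∀ i ∈ s, ReluBound (h i) (R i)) (h0 : ∀ i ∈ s, 0 ≤ R i) :
    ReluBound (fun x => ∑ i ∈ s, h i x) (∑ i ∈ s, R i) := by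
  classical
  induction s using Finset.induction_on with
  | empty => intro S c _; simp
  | insert i s hi ih =>
    simp only [Finset.sum_insert hi]
    exact (hh i (Finset.mem_insert_self i s)).add
      (ih (fun j hj => hh j (Finset.mem_insert_of_mem hj))
        fun j hj => h0 j (Finset.mem_insert_of_mem hj))
      (h0 i (Finset.mem_insert_self i s))
      (Finset.sum_nonneg fun j hj => h0 j (Finset.mem_insert_of_mem hj))

/-- For the constant function the squared sum is the degree `0` term of the energy divided by
`reluCoeff 0`; the remaining terms are nonnegative and dropped. -/
theorem reluBound_one : ReluBound (fun _ : EuclideanSpace ℝ (Fin d) => 1)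
    (1 / √(reluCoeff 0)) := by
  intro S c hS
  have h := hasSum_reluEnergy hS c
  have h0 := h.summable.le_tsum 0 fun n _ =>
    mul_nonneg (reluCoeff_pos n).le (sum_sum_inner_pow_nonneg S c n)
  rw [h.tsum_eq] at h0
  have hb := reluCoeff_pos 0
  rw [div_pow, Real.sq_sqrt hb.le, one_pow, one_div, le_inv_mul_iff₀ hb]
  refine le_trans (le_of_eq ?_) h0
  simp only [mul_one, pow_zero, sq, Finset.sum_mul_sum]

/-- Cauchy–Schwarz in `L²` between `a` and the combination of features. -/
theorem IsReluRepresentation.reluBound {a : (Fin (d + 1) → ℝ) → ℝ}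
    {g : EuclideanSpace ℝ (Fin d) → ℝ} (ha : IsReluRepresentation a g) {R : ℝ} (hR : 0 ≤ R)
    (hn : eLpNorm a 2 (unitLaw d) ≤ ENNReal.ofReal R) : ReluBound g R := by
  intro S c hS
  have hm := memLp_sum_reluFeature S c
  have hi : ∀ x, Integrable (fun w => a w * reluFeature x w) (unitLaw d) := fun x =>
    ha.1.integrable_mul (memLp_reluFeature x (r := 2) ENNReal.ofNat_ne_top)
  have e : ∑ x ∈ S, c x * g x
      = ∫ w, a w * (∑ x ∈ S, c x * reluFeature x w) ∂(unitLaw d) := by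
    simp only [Finset.mul_sum]
    rw [integral_finsetSum _ fun x _ => ?_]
    · refine Finset.sum_congr rfl fun x hx => ?_
      rw [ha.2 x (hS x hx), ← integral_const_mul]
      congr 1
      funext w
      simp only [reluFeature]
      ring
    · exact ((hi x).const_mul (c x)).congr (.of_forall fun w => by simp only; ring)
  have h1 : ‖hm.toLp‖ ^ 2 = reluEnergy S c := by
    rw [← real_inner_self_eq_norm_sq, L2.inner_def, reluEnergy]
    refine integral_congr_ae (hm.coeFn_toLp.mono fun w hw => ?_)
    simp only [hw, RCLike.inner_apply, conj_trivial, sq]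
  have h2 : ‖ha.1.toLp‖ ≤ R := by
    rw [Lp.norm_toLp]
    exact ENNReal.toReal_le_of_le_ofReal hR hn
  have h3 : ∑ x ∈ S, c x * g x = inner ℝ ha.1.toLp hm.toLp := by
    rw [e, L2.inner_def]
    refine integral_congr_ae ?_
    filter_upwards [hm.coeFn_toLp, ha.1.coeFn_toLp] with w h1 h2
    simp only [h1, h2, RCLike.inner_apply, conj_trivial, mul_comm]
  rw [h3, ← h1, ← mul_pow, ← sq_abs]
  gcongr
  exact (abs_real_inner_le_norm _ _).trans (by gcongr)

/-- The extra `1` avoids having to show that the infimum is attained. -/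
theorem ReluBound.of_reluNorm_le {g : EuclideanSpace ℝ (Fin d) → ℝ} {R : ℝ≥0}
    (h : reluNorm g ≤ R) : ReluBound g (R + 1) := by
  have h1 : reluNorm g < ENNReal.ofReal (R + 1) := by
    refine h.trans_lt ?_
    rw [← ENNReal.ofReal_coe_nnreal]
    exact (ENNReal.ofReal_lt_ofReal_iff (by positivity)).2 (by linarith)
  simp only [reluNorm, iInf_lt_iff] at h1
  obtain ⟨a, ha, hn⟩ := h1
  exact ha.reluBound (by positivity) hn.le

/-- The bound for `h` absorbs `h'` into the coefficients. The bound for `h'` is then applied for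
each fixed `w` to the coefficients `c x * reluFeature x w` and integrated over `w`, which produces
the squared kernel. The convolution bound and positivity of the powers of the inner product compare
the squared kernel with the kernel, degree by degree. -/
theorem exists_reluBound_mul : ∃ L : ℝ, 1 ≤ L ∧ ∀ (d : ℕ)
    (h h' : EuclideanSpace ℝ (Fin d) → ℝ) (R R' : ℝ), ReluBound h R → ReluBound h' R' →
    ReluBound (fun x => h x * h' x) (L * (R * R')) := by
  obtain ⟨L, hL, hconv⟩ := reluCoeff_conv_le
  -- The argument yields `√L`; adding `1` makes the constant at least `1`, so that its powers grow
  -- with the degree.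
  refine ⟨√L + 1, by linarith [Real.sqrt_nonneg L], fun d h h' R R' hh hh' S c hS => ?_⟩
  have key : ∑ x ∈ S, ∑ y ∈ S, c x * c y * reluKernel x y ^ 2 ≤ L * reluEnergy S c := by
    have s1 : HasSum (fun n => (∑ p ∈ Finset.HasAntidiagonal.antidiagonal n,
        reluCoeff p.1 * reluCoeff p.2) * ∑ x ∈ S, ∑ y ∈ S, c x * c y * inner ℝ x y ^ n)
        (∑ x ∈ S, ∑ y ∈ S, c x * c y * reluKernel x y ^ 2) := by
      have : HasSum (fun n => ∑ x ∈ S, ∑ y ∈ S, c x * c y *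
          ((∑ p ∈ Finset.HasAntidiagonal.antidiagonal n, reluCoeff p.1 * reluCoeff p.2) *
            inner ℝ x y ^ n)) (∑ x ∈ S, ∑ y ∈ S, c x * c y * reluKernel x y ^ 2) :=
        hasSum_sum fun x hx => hasSum_sum fun y hy =>
          (hasSum_reluKernel_sq (hS x hx) (hS y hy)).mul_left (c x * c y)
      convert this using 2
      rw [Finset.mul_sum]
      refine Finset.sum_congr rfl fun x _ => ?_
      rw [Finset.mul_sum]
      exact Finset.sum_congr rfl fun y _ => by ring
    refine hasSum_le (fun n => ?_) s1 ((hasSum_reluEnergy hS c).mul_left L)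
    rw [← mul_assoc]
    exact mul_le_mul_of_nonneg_right (hconv n) (sum_sum_inner_pow_nonneg S c n)
  have hsplit : ∀ w, reluEnergy S (fun x => c x * reluFeature x w)
      = ∑ x ∈ S, ∑ y ∈ S, c x * c y * reluKernel x y * (reluFeature x w * reluFeature y w) := by
    intro w
    rw [reluEnergy_eq]
    exact Finset.sum_congr rfl fun x _ => Finset.sum_congr rfl fun y _ => by ring
  have hint : ∀ x y : EuclideanSpace ℝ (Fin d), Integrable (fun w =>
      c x * c y * reluKernel x y * (reluFeature x w * reluFeature y w)) (unitLaw d) :=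
    fun x y => (integrable_reluFeature_mul x y).const_mul _
  have h2 : reluEnergy S (fun x => c x * h' x)
      ≤ R' ^ 2 * ∑ x ∈ S, ∑ y ∈ S, c x * c y * reluKernel x y ^ 2 := by
    have e : ∑ x ∈ S, ∑ y ∈ S, c x * c y * reluKernel x y ^ 2
        = ∫ w, reluEnergy S (fun x => c x * reluFeature x w) ∂(unitLaw d) := by
      simp only [hsplit]
      rw [integral_finsetSum _ fun x _ => integrable_finsetSum _ fun y _ => hint x y]
      refine Finset.sum_congr rfl fun x _ => ?_
      rw [integral_finsetSum _ fun y _ => hint x y]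
      refine Finset.sum_congr rfl fun y _ => ?_
      rw [integral_const_mul, ← reluKernel]
      ring
    rw [e, ← integral_const_mul]
    refine integral_mono (memLp_sum_reluFeature S _).integrable_sq ?_ fun w => ?_
    · simp only [hsplit]
      exact (integrable_finsetSum _ fun x _ => integrable_finsetSum _ fun y _ =>
        hint x y).const_mul _
    · refine le_trans (le_of_eq ?_) (hh' S (fun x => c x * reluFeature x w) hS)
      congr 1
      exact Finset.sum_congr rfl fun x _ => by ring
  calc (∑ x ∈ S, c x * (h x * h' x)) ^ 2 = (∑ x ∈ S, (c x * h' x) * h x) ^ 2 := by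
        congr 1
        exact Finset.sum_congr rfl fun x _ => by ring
    _ ≤ R ^ 2 * reluEnergy S (fun x => c x * h' x) := hh S (fun x => c x * h' x) hS
    _ ≤ R ^ 2 * (R' ^ 2 * (L * reluEnergy S c)) := by
        gcongr
        exact h2.trans (by gcongr)
    _ = (√L * (R * R')) ^ 2 * reluEnergy S c := by
        rw [mul_pow, mul_pow, Real.sq_sqrt hL.le]; ring
    _ ≤ _ := by
        refine mul_le_mul_of_nonneg_right ?_ (reluEnergy_nonneg S c)
        rw [mul_pow, mul_pow _ (R * R')]
        gcongr
        linarith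

/-- The bound says that sending a combination of features to the same combination of values of `h`
is well defined on their span in `L²`, with norm at most `R`. Hahn–Banach extends this functional
and Riesz represents it by the desired `a`. -/
theorem ReluBound.exists_representation {h : EuclideanSpace ℝ (Fin d) → ℝ} {R : ℝ} (hR : 0 ≤ R)
    (hh : ReluBound h R) : ∃ a : (Fin (d + 1) → ℝ) → ℝ, IsReluRepresentation a h ∧
      ∫ w, a w ^ 2 ∂(unitLaw d) ≤ R ^ 2 := by
  classical
  let U := {x : EuclideanSpace ℝ (Fin d) // ‖x‖ = 1}
  let feat : U → Lp ℝ 2 (unitLaw d) := fun x =>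
    (memLp_reluFeature x.1 ENNReal.ofNat_ne_top).toLp
  let F : (U →₀ ℝ) →ₗ[ℝ] Lp ℝ 2 (unitLaw d) := Finsupp.linearCombination ℝ feat
  let ℓ : (U →₀ ℝ) →ₗ[ℝ] ℝ := Finsupp.linearCombination ℝ fun x : U => h x.1
  have hbound : ∀ c : U →₀ ℝ, ‖ℓ c‖ ≤ R * ‖F c‖ := by
    intro c
    set S : Finset (EuclideanSpace ℝ (Fin d)) := c.support.map (Function.Embedding.subtype _)
    set c' : EuclideanSpace ℝ (Fin d) → ℝ := fun x => if hx : ‖x‖ = 1 then c ⟨x, hx⟩ else 0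
    have hS : ∀ x ∈ S, ‖x‖ = 1 := by
      intro x hx
      obtain ⟨y, -, rfl⟩ := Finset.mem_map.1 hx
      exact y.2
    have hc' : ∀ x : U, c' x.1 = c x := fun x => by simp [c', x.2]
    have e1 : ℓ c = ∑ x ∈ S, c' x * h x := by
      simp [ℓ, Finsupp.linearCombination_apply, Finsupp.sum, S, hc']
      rfl
    have hm := memLp_sum_reluFeature S c'
    have e2 : F c = hm.toLp := by
      apply Lp.ext
      simp only [F, Finsupp.linearCombination_apply, Finsupp.sum]
      refine (Lp.coeFn_finsetSum _ _).trans ?_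
      have hall : ∀ᵐ w ∂(unitLaw d), ∀ x ∈ c.support,
          (c x • feat x : Lp ℝ 2 (unitLaw d)) w = c x * reluFeature x.1 w := by
        rw [Finset.eventually_all]
        intro x _
        filter_upwards [Lp.coeFn_smul (c x) (feat x),
          (memLp_reluFeature x.1 ENNReal.ofNat_ne_top (r := 2)).coeFn_toLp] with w h1 h2
        rw [h1, Pi.smul_apply, smul_eq_mul, h2]
      filter_upwards [hm.coeFn_toLp, hall] with w h1 h2
      rw [h1, Finset.sum_apply, Finset.sum_congr rfl h2]
      simp [S, hc']
      rfl
    have e3 : ‖hm.toLp‖ ^ 2 = reluEnergy S c' := by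
      rw [← real_inner_self_eq_norm_sq, L2.inner_def, reluEnergy]
      refine integral_congr_ae (hm.coeFn_toLp.mono fun w hw => ?_)
      simp only [hw, RCLike.inner_apply, conj_trivial, sq]
    rw [Real.norm_eq_abs]
    refine abs_le_of_sq_le_sq ?_ (by positivity)
    rw [mul_pow, e2, e3, e1]
    exact hh S c' hS
  obtain ⟨sec, hsec⟩ := F.rangeRestrict.exists_rightInverse_of_surjective
    F.range_rangeRestrict
  have hsec' : ∀ v : LinearMap.range F, F (sec v) = v := fun v => by
    have := LinearMap.congr_fun hsec v
    exact congrArg Subtype.val this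
  let f : StrongDual ℝ (LinearMap.range F) := (ℓ ∘ₗ sec).mkContinuous R fun v => by
    have := hbound (sec v)
    rw [hsec' v] at this
    exact this
  have hf : ‖f‖ ≤ R := LinearMap.mkContinuous_norm_le _ hR _
  have hfF : ∀ c, f ⟨F c, LinearMap.mem_range_self F c⟩ = ℓ c := by
    intro c
    have h1 := hbound (sec ⟨F c, LinearMap.mem_range_self F c⟩ - c)
    rw [map_sub F, hsec', sub_self, norm_zero, mul_zero, map_sub ℓ] at h1
    exact sub_eq_zero.1 (norm_le_zero_iff.1 h1)
  obtain ⟨f', hf', hnorm⟩ := exists_extension_norm_eq (LinearMap.range F) f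
  set v := (InnerProductSpace.toDual ℝ (Lp ℝ 2 (unitLaw d))).symm f'
  refine ⟨v, ⟨Lp.memLp v, fun x hx => ?_⟩, ?_⟩
  · have h1 := hfF (Finsupp.single ⟨x, hx⟩ 1)
    rw [← hf'] at h1
    have e1 : F (Finsupp.single ⟨x, hx⟩ 1) = feat ⟨x, hx⟩ := by simp [F]
    have e2 : ℓ (Finsupp.single ⟨x, hx⟩ 1) = h x := by simp [ℓ]
    simp only [e1, e2] at h1
    rw [← h1, ← InnerProductSpace.toDual_symm_apply, L2.inner_def]
    refine integral_congr_ae ?_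
    filter_upwards [(memLp_reluFeature x ENNReal.ofNat_ne_top (r := 2)).coeFn_toLp] with w hw
    simp only [feat, hw, RCLike.inner_apply, conj_trivial]
    exact mul_comm _ _
  · have hv : ‖v‖ ≤ R := by
      rw [LinearIsometryEquiv.norm_map, hnorm]
      exact hf
    have : ∫ w, v w ^ 2 ∂(unitLaw d) = ‖v‖ ^ 2 := by
      rw [← real_inner_self_eq_norm_sq, L2.inner_def]
      simp [sq]
    rw [this]
    gcongr

end ReluKernel

/-! ### Gaussian random projection of Johnson–Lindenstrauss type. -/

section RandomProjection

theorem integral_exp_mul_sq_gaussianReal {r : ℝ} (hr : r < 1 / 2) :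
    ∫ x, Real.exp (r * x ^ 2) ∂(gaussianReal 0 1) = 1 / √(1 - 2 * r) := by
  rw [integral_gaussianReal_eq_integral_smul one_ne_zero]
  have e : ∀ x : ℝ, gaussianPDFReal 0 1 x • Real.exp (r * x ^ 2)
      = (√(2 * Real.pi))⁻¹ * Real.exp (-(1 / 2 - r) * x ^ 2) := by
    intro x
    simp only [gaussianPDFReal_def, NNReal.coe_one, mul_one, sub_zero, smul_eq_mul]
    rw [mul_assoc, ← Real.exp_add]
    congr 2
    ring
  simp only [e]
  have h1 : (0 : ℝ) < 1 / 2 - r := by linarith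
  have hpi := Real.pi_pos
  rw [integral_const_mul, integral_gaussian, ← Real.sqrt_inv, ← Real.sqrt_mul (by positivity),
    one_div (√_), ← Real.sqrt_inv]
  congr 1
  field_simp

/-- Used with `x = 2r` to turn the exact chi-square transform `(1 - 2r)^(-1/2)` into a sub-Gaussian
bound near `0`. -/
theorem exp_neg_sub_sq_le {x : ℝ} (h1 : -1 / 2 ≤ x) (h2 : x ≤ 1 / 2) :
    Real.exp (-x - x ^ 2) ≤ 1 - x := by
  rcases le_total 0 x with h | h
  · have hy : 0 ≤ x + x ^ 2 := by positivity
    have h3 := Real.quadratic_le_exp_of_nonneg hy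
    rw [show -x - x ^ 2 = -(x + x ^ 2) by ring, Real.exp_neg]
    refine inv_le_of_inv_le₀ (by linarith) (le_trans ?_ h3)
    rw [inv_le_iff_one_le_mul₀ (by linarith)]
    have h4 : 0 ≤ (1 + x) * (1 - x ^ 2) - 2 * x := by nlinarith
    nlinarith [mul_nonneg (sq_nonneg x) h4]
  · have h3 : 0 < 1 + x + x ^ 2 := by nlinarith [sq_nonneg (x + 1 / 2)]
    have h4 := Real.add_one_le_exp (x + x ^ 2)
    rw [show -x - x ^ 2 = -(x + x ^ 2) by ring, Real.exp_neg]
    refine inv_le_of_inv_le₀ (by linarith) (le_trans ?_ h4)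
    rw [inv_le_iff_one_le_mul₀ (by linarith)]
    have : 0 ≤ -(x ^ 3) := by
      have := mul_nonneg (sq_nonneg x) (neg_nonneg.2 h)
      linarith [this, show x ^ 2 * -x = -(x ^ 3) by ring]
    nlinarith

theorem integral_exp_mul_sq_le {r : ℝ} (h1 : -1 / 4 ≤ r) (h2 : r ≤ 1 / 4) :
    ∫ x, Real.exp (r * x ^ 2) ∂(gaussianReal 0 1) ≤ Real.exp (r + 2 * r ^ 2) := by
  rw [integral_exp_mul_sq_gaussianReal (by linarith)]
  have h := exp_neg_sub_sq_le (x := 2 * r) (by linarith) (by linarith)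
  have h3 : Real.exp (r + 2 * r ^ 2) = (√(Real.exp (-(2 * r) - (2 * r) ^ 2)))⁻¹ := by
    rw [Real.sqrt_eq_rpow, ← Real.exp_mul, ← Real.exp_neg]
    congr 1
    ring
  rw [h3, one_div]
  gcongr

variable {N : Type*} [Fintype N] {T : ℕ}

/-- The law of a `T × N` matrix with independent standard Gaussian entries. -/
abbrev gaussianMatrixLaw (T : ℕ) (N : Type*) [Fintype N] : Measure (Fin T → N → ℝ) :=
  Measure.pi fun _ => stdLaw N

theorem mgf_sum_sq {p : N → ℝ} (hp : p ⬝ᵥ p = 1) (r : ℝ) :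
    mgf (fun G : Fin T → N → ℝ => ∑ t, (G t ⬝ᵥ p) ^ 2) (gaussianMatrixLaw T N) r
      = (∫ x, Real.exp (r * x ^ 2) ∂(gaussianReal 0 1)) ^ T := by
  have hm : Measurable fun w : N → ℝ => w ⬝ᵥ p := by unfold dotProduct; fun_prop
  have h1 := map_dotProduct_stdLaw p
  rw [hp, Real.toNNReal_one] at h1
  rw [mgf, ← h1, integral_map hm.aemeasurable (by fun_prop)]
  have := integral_fintype_prod_eq_pow (ι := Fin T) (μ := stdLaw N)
    (fun w : N → ℝ => Real.exp (r * (w ⬝ᵥ p) ^ 2))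
  rw [Fintype.card_fin] at this
  rw [← this]
  congr 1
  funext G
  simp only [Finset.mul_sum, Real.exp_sum]

/-- Chernoff's bound for both tails, at the parameters `±w/4`, which minimise `-rw + 2r²` up to
sign. -/
theorem measureReal_sum_sq_tail {p : N → ℝ} (hp : p ⬝ᵥ p = 1) {w : ℝ} (hw : 0 < w) (hw1 : w ≤ 1) :
    (gaussianMatrixLaw T N).real {G | T * w ≤ |∑ t, (G t ⬝ᵥ p) ^ 2 - T|}
      ≤ 2 * Real.exp (-(T * w ^ 2 / 8)) := by
  set X : (Fin T → N → ℝ) → ℝ := fun G => ∑ t, (G t ⬝ᵥ p) ^ 2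
  have hint : ∀ r : ℝ, r < 1 / 2 →
      Integrable (fun G => Real.exp (r * X G)) (gaussianMatrixLaw T N) := by
    intro r hr
    refine Integrable.of_integral_ne_zero ?_
    change mgf X (gaussianMatrixLaw T N) r ≠ 0
    rw [mgf_sum_sq hp, integral_exp_mul_sq_gaussianReal hr]
    have : 0 < 1 - 2 * r := by linarith
    positivity
  have hmgf : ∀ r : ℝ, -1 / 4 ≤ r → r ≤ 1 / 4 →
      mgf X (gaussianMatrixLaw T N) r ≤ Real.exp (T * (r + 2 * r ^ 2)) := by
    intro r h1 h2
    rw [mgf_sum_sq hp, Real.exp_nat_mul]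
    exact pow_le_pow_left₀ (integral_nonneg fun x => (Real.exp_pos (r * x ^ 2)).le)
      (integral_exp_mul_sq_le h1 h2) T
  have hu := measure_ge_le_exp_mul_mgf (μ := gaussianMatrixLaw T N) (X := X) (t := w / 4)
    (T * (1 + w)) (by positivity) (hint _ (by linarith))
  have hl := measure_le_le_exp_mul_mgf (μ := gaussianMatrixLaw T N) (X := X) (t := -(w / 4))
    (T * (1 - w)) (by linarith) (hint _ (by linarith))
  have hu' := hu.trans (mul_le_mul_of_nonneg_left (hmgf (w / 4) (by linarith) (by linarith))
    (Real.exp_pos _).le)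
  have hl' := hl.trans (mul_le_mul_of_nonneg_left (hmgf (-(w / 4)) (by linarith) (by linarith))
    (Real.exp_pos _).le)
  rw [← Real.exp_add] at hu' hl'
  have eu : -(w / 4) * (T * (1 + w)) + T * (w / 4 + 2 * (w / 4) ^ 2) = -(T * w ^ 2 / 8) := by
    ring
  have el : -(-(w / 4)) * (T * (1 - w)) + T * (-(w / 4) + 2 * (-(w / 4)) ^ 2)
      = -(T * w ^ 2 / 8) := by ring
  rw [eu] at hu'
  rw [el] at hl'
  have hsub : {G | T * w ≤ |X G - T|} ⊆ {G | T * (1 + w) ≤ X G} ∪ {G | X G ≤ T * (1 - w)} := by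
    intro G hG
    rcases le_abs.1 (Set.mem_ofPred_eq ▸ hG) with h | h
    · left; simp only [Set.mem_ofPred_eq]; linarith
    · right; simp only [Set.mem_ofPred_eq]; linarith
  refine (measureReal_mono hsub).trans ((measureReal_union_le _ _).trans ?_)
  linarith

theorem measureReal_sum_sq_deviation_le {p : N → ℝ} {w : ℝ} (hw : 0 < w) (hw1 : w ≤ 1) :
    (gaussianMatrixLaw T N).real {G | T * w * (p ⬝ᵥ p) < |∑ t, (G t ⬝ᵥ p) ^ 2 - T * (p ⬝ᵥ p)|}
      ≤ 2 * Real.exp (-(T * w ^ 2 / 8)) := by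
  have hp : 0 ≤ p ⬝ᵥ p := by simpa using dotProduct_star_self_nonneg p
  rcases hp.eq_or_lt with h0 | h0
  · have : p = 0 := dotProduct_self_eq_zero.1 h0.symm
    simp [this]
    positivity
  · set q := p ⬝ᵥ p
    have hs : 0 < √q := Real.sqrt_pos.2 h0
    have hs2 : √q * √q = q := Real.mul_self_sqrt hp
    have hunit : ((√q)⁻¹ • p) ⬝ᵥ ((√q)⁻¹ • p) = 1 := by
      simp only [smul_dotProduct, dotProduct_smul, smul_eq_mul]
      change (√q)⁻¹ * ((√q)⁻¹ * q) = 1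
      rw [← mul_assoc, ← mul_inv, hs2, inv_mul_cancel₀ h0.ne']
    refine (measureReal_mono ?_).trans (measureReal_sum_sq_tail hunit hw hw1)
    intro G hG
    simp only [Set.mem_ofPred_eq] at hG ⊢
    have e : ∑ t, (G t ⬝ᵥ ((√q)⁻¹ • p)) ^ 2 = q⁻¹ * ∑ t, (G t ⬝ᵥ p) ^ 2 := by
      rw [Finset.mul_sum]
      refine Finset.sum_congr rfl fun t _ => ?_
      rw [dotProduct_smul, smul_eq_mul, mul_pow, inv_pow, Real.sq_sqrt hp]
    have e2 : q⁻¹ * ∑ t, (G t ⬝ᵥ p) ^ 2 - T = (∑ t, (G t ⬝ᵥ p) ^ 2 - T * q) / q := by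
      field_simp
    rw [e, e2, abs_div, abs_of_pos h0, le_div_iff₀ h0]
    exact hG.le

theorem integral_sum_sq_entries :
    Integrable (fun G : Fin T → N → ℝ => ∑ t, ∑ i, G t i ^ 2) (gaussianMatrixLaw T N) ∧
    ∫ G, ∑ t, ∑ i, G t i ^ 2 ∂(gaussianMatrixLaw T N) = T * Fintype.card N := by
  have hmp : ∀ (t : Fin T) (i : N), MeasurePreserving (fun G : Fin T → N → ℝ => G t i)
      (gaussianMatrixLaw T N) (gaussianReal 0 1) := fun t i =>
    (measurePreserving_eval (fun _ : N => gaussianReal 0 1) i).comp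
      (measurePreserving_eval (fun _ : Fin T => stdLaw N) t)
  have hsq : Integrable (fun x : ℝ => x ^ 2) (gaussianReal 0 1) :=
    (memLp_id_gaussianReal 2).integrable_sq
  have hint : ∀ (t : Fin T) (i : N),
      Integrable (fun G : Fin T → N → ℝ => G t i ^ 2) (gaussianMatrixLaw T N) := fun t i =>
    (hmp t i).integrable_comp_of_integrable hsq
  have hval : ∫ x : ℝ, x ^ 2 ∂(gaussianReal 0 1) = 1 := by
    have h := variance_fun_id_gaussianReal (μ := 0) (v := 1)
    rw [variance_eq_integral (by fun_prop)] at h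
    simpa using h
  refine ⟨integrable_finsetSum _ fun t _ => integrable_finsetSum _ fun i _ => hint t i, ?_⟩
  rw [integral_finsetSum _ fun t _ => integrable_finsetSum _ fun i _ => hint t i]
  have : ∀ t : Fin T, ∫ G, ∑ i, G t i ^ 2 ∂(gaussianMatrixLaw T N) = Fintype.card N := by
    intro t
    rw [integral_finsetSum _ fun i _ => hint t i]
    have : ∀ i : N, ∫ G, G t i ^ 2 ∂(gaussianMatrixLaw T N) = 1 := by
      intro i
      rw [← hval, ← (hmp t i).map_eq, integral_map (hmp t i).measurable.aemeasurable (by fun_prop)]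
    simp [this]
  simp [this]

/-- A quantitative random projection lemma: a Gaussian `T × N` matrix preserves all inner products
of `m` unit vectors up to an error `w`. -/
theorem exists_matrix_preserving_inner [Nonempty N] {m : ℕ} (φ : Fin m → N → ℝ)
    (hφ : ∀ l, φ l ⬝ᵥ φ l = 1) {w : ℝ} (hw : 0 < w) (hw1 : w ≤ 1) (hT : 0 < T)
    (hm : 4 * (m : ℝ) ^ 2 * Real.exp (-(T * w ^ 2 / 8)) < 1 / 2) :
    ∃ G : Fin T → N → ℝ, ∑ t, ∑ i, G t i ^ 2 ≤ 2 * (T * Fintype.card N) ∧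
      ∀ l j, |(1 / (T : ℝ)) * ∑ t, (G t ⬝ᵥ φ l) * (G t ⬝ᵥ φ j) - φ l ⬝ᵥ φ j| ≤ w := by
  set μ := gaussianMatrixLaw T N
  set bad : (N → ℝ) → Set (Fin T → N → ℝ) := fun p =>
    {G | T * w * (p ⬝ᵥ p) < |∑ t, (G t ⬝ᵥ p) ^ 2 - T * (p ⬝ᵥ p)|}
  -- Markov's inequality gives this event probability at most `1/2`, which is why the other bad
  -- events must total strictly less than `1/2`.
  set heavy : Set (Fin T → N → ℝ) := {G | 2 * (T * Fintype.card N) ≤ ∑ t, ∑ i, G t i ^ 2}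
  have hcard : (0 : ℝ) < T * Fintype.card N := by
    have : 0 < Fintype.card N := Fintype.card_pos
    positivity
  have hheavy : μ.real heavy ≤ 1 / 2 := by
    have h := mul_meas_ge_le_integral_of_nonneg (μ := μ) (.of_forall fun G => by positivity)
      (integral_sum_sq_entries (N := N) (T := T)).1 (2 * (T * Fintype.card N))
    rw [integral_sum_sq_entries.2] at h
    have h2 : (2 * μ.real heavy) * (T * Fintype.card N) ≤ 1 * (T * Fintype.card N) := by
      linarith [h]
    linarith [le_of_mul_le_mul_right h2 hcard]
  -- By polarization, controlling the norms of all sums and differences controls all inner products.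
  -- The factor `4` is two vectors per pair times two tails.
  set B : Set (Fin T → N → ℝ) := ⋃ z : Fin m × Fin m, bad (φ z.1 + φ z.2) ∪ bad (φ z.1 - φ z.2)
  have hB : μ.real B ≤ 4 * (m : ℝ) ^ 2 * Real.exp (-(T * w ^ 2 / 8)) := by
    refine (measureReal_iUnion_fintype_le _).trans ?_
    refine (Finset.sum_le_sum fun z _ => (measureReal_union_le _ _).trans
      (add_le_add (measureReal_sum_sq_deviation_le hw hw1)
        (measureReal_sum_sq_deviation_le hw hw1))).trans (le_of_eq ?_)
    simp only [Finset.sum_const, Finset.card_univ, Fintype.card_prod, Fintype.card_fin,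
      nsmul_eq_mul]
    push_cast
    ring
  have hne : B ∪ heavy ≠ Set.univ := by
    intro h
    have h1 := measureReal_union_le (μ := μ) B heavy
    rw [h, probReal_univ] at h1
    linarith
  obtain ⟨G, hG⟩ := (Set.ne_univ_iff_exists_notMem _).1 hne
  simp only [Set.mem_union, not_or, B, Set.mem_iUnion, not_exists, Prod.forall, bad, heavy,
    Set.mem_ofPred_eq] at hG
  refine ⟨G, (not_le.1 hG.2).le, fun l j => ?_⟩
  have h1 := not_lt.1 (hG.1 l j).1
  have h2 := not_lt.1 (hG.1 l j).2
  have hTr : (0 : ℝ) < T := by exact_mod_cast hT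
  have e1 : ∀ t, G t ⬝ᵥ (φ l + φ j) = G t ⬝ᵥ φ l + G t ⬝ᵥ φ j := fun t => dotProduct_add _ _ _
  have e2 : ∀ t, G t ⬝ᵥ (φ l - φ j) = G t ⬝ᵥ φ l - G t ⬝ᵥ φ j := fun t => dotProduct_sub _ _ _
  have n1 : (φ l + φ j) ⬝ᵥ (φ l + φ j) = 2 + 2 * (φ l ⬝ᵥ φ j) := by
    simp only [dotProduct_add, add_dotProduct, hφ, dotProduct_comm (φ j) (φ l)]; ring
  have n2 : (φ l - φ j) ⬝ᵥ (φ l - φ j) = 2 - 2 * (φ l ⬝ᵥ φ j) := by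
    simp only [dotProduct_sub, sub_dotProduct, hφ, dotProduct_comm (φ j) (φ l)]; ring
  simp only [e1, n1] at h1
  simp only [e2, n2] at h2
  have e3 : ∑ t, (G t ⬝ᵥ φ l) * (G t ⬝ᵥ φ j) = (∑ t, (G t ⬝ᵥ φ l + G t ⬝ᵥ φ j) ^ 2
      - ∑ t, (G t ⬝ᵥ φ l - G t ⬝ᵥ φ j) ^ 2) / 4 := by
    rw [← Finset.sum_sub_distrib, Finset.sum_div]
    exact Finset.sum_congr rfl fun t _ => by ring
  have e4 : (1 / (T : ℝ)) * ∑ t, (G t ⬝ᵥ φ l) * (G t ⬝ᵥ φ j) - φ l ⬝ᵥ φ j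
      = (∑ t, (G t ⬝ᵥ φ l) * (G t ⬝ᵥ φ j) - T * (φ l ⬝ᵥ φ j)) / T := by field_simp
  rw [e4, abs_div, abs_of_pos hTr, div_le_iff₀ hTr, e3]
  rw [abs_le] at h1 h2 ⊢
  constructor <;> nlinarith [h1.1, h1.2, h2.1, h2.2]

end RandomProjection

/-! ### From infinite to finite width. -/

section Sampling

variable {d D : ℕ}

/-- The law of `D` independent unnormalised weight vectors. -/
abbrev sampleLaw (D d : ℕ) : Measure (Fin D → Fin (d + 1) → ℝ) := Measure.pi fun _ => unitLaw d

theorem layerLaw_apply (hD : 0 < D) (s : Set (Fin D → Fin (d + 1) → ℝ)) :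
    layerLaw D d s = sampleLaw D d {W | (√D)⁻¹ • W ∈ s} := by
  have hD' : (0 : ℝ) < D := by exact_mod_cast hD
  have hc : (√(D : ℝ))⁻¹ ≠ 0 := (inv_pos.2 (Real.sqrt_pos.2 hD')).ne'
  have e : (sampleLaw D d).map (MeasurableEquiv.smul₀ (√(D : ℝ))⁻¹ hc) = layerLaw D d := by
    have h0 : (gaussianReal 0 1).map ((√(D : ℝ))⁻¹ * ·) = gaussianReal 0 ((D : ℝ≥0)⁻¹) := by
      rw [gaussianReal_map_const_mul]
      congr 1
      · simp
      · ext
        simp [Real.sq_sqrt hD'.le]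
    have h1 : (unitLaw d).map (fun w j => (√(D : ℝ))⁻¹ * w j)
        = Measure.pi fun _ => gaussianReal 0 ((D : ℝ≥0)⁻¹) := by
      unfold unitLaw
      have : ∀ _ : Fin (d + 1), SigmaFinite ((gaussianReal 0 1).map ((√(D : ℝ))⁻¹ * ·)) := by
        intro _; rw [h0]; infer_instance
      rw [Measure.pi_map_pi (f := fun _ x => (√(D : ℝ))⁻¹ * x) fun _ => by fun_prop, h0]
    have : ∀ _ : Fin D, SigmaFinite ((unitLaw d).map (fun w j => (√(D : ℝ))⁻¹ * w j)) := by
      intro _; rw [h1]; infer_instance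
    have h2 := Measure.pi_map_pi (μ := fun _ : Fin D => unitLaw d)
      (f := fun _ (w : Fin (d + 1) → ℝ) j => (√(D : ℝ))⁻¹ * w j) fun _ =>
        (measurable_pi_lambda _ fun j => (measurable_pi_apply j).const_mul _).aemeasurable
    rw [h1] at h2
    exact h2
  rw [← e, MeasurableEquiv.map_apply]
  rfl

/-- Chebyshev's inequality for an empirical mean. -/
theorem sampleLaw_deviation_le {f : (Fin (d + 1) → ℝ) → ℝ} (hf : MemLp f 2 (unitLaw d))
    (hD : 0 < D) {η Q : ℝ} (hη : 0 < η) (hQ : ∫ w, f w ^ 2 ∂(unitLaw d) ≤ Q) :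
    (sampleLaw D d).real {W | η ≤ |(1 / (D : ℝ)) * ∑ i, f (W i) - ∫ w, f w ∂(unitLaw d)|}
      ≤ Q / η ^ 2 / D := by
  have hD' : (0 : ℝ) < D := by exact_mod_cast hD
  set X : (Fin D → Fin (d + 1) → ℝ) → ℝ := ∑ i, fun W => f (W i)
  have hfi : ∀ i : Fin D, MemLp (fun W : Fin D → Fin (d + 1) → ℝ => f (W i)) 2 (sampleLaw D d) :=
    fun i => hf.comp_measurePreserving (measurePreserving_eval (fun _ => unitLaw d) i)
  have hX : MemLp X 2 (sampleLaw D d) := memLp_finsetSum' _ fun i _ => hfi i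
  have hmean : ∫ W, X W ∂(sampleLaw D d) = D * ∫ w, f w ∂(unitLaw d) := by
    simp only [X, Finset.sum_apply]
    rw [integral_finsetSum _ fun i _ => (hfi i).integrable one_le_two]
    have : ∀ i : Fin D, ∫ W, f (W i) ∂(sampleLaw D d) = ∫ w, f w ∂(unitLaw d) := by
      intro i
      have hmp := measurePreserving_eval (fun _ : Fin D => unitLaw d) i
      have hfm : AEStronglyMeasurable f (Measure.map (Function.eval i) (sampleLaw D d)) := by
        rw [hmp.map_eq]; exact hf.1
      rw [← hmp.map_eq, integral_map hmp.measurable.aemeasurable hfm]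
    simp [this]
  have hvar : variance X (sampleLaw D d) ≤ D * Q := by
    have := variance_sum_pi (μ := fun _ : Fin D => unitLaw d) (X := fun _ => f) fun _ => hf
    rw [this]
    simp only [Finset.sum_const, Finset.card_univ, Fintype.card_fin, nsmul_eq_mul]
    gcongr
    exact (variance_le_expectation_sq hf.1).trans hQ
  have h := meas_ge_le_variance_div_sq hX (c := D * η) (by positivity)
  have hset : {W : Fin D → Fin (d + 1) → ℝ |
      η ≤ |(1 / (D : ℝ)) * ∑ i, f (W i) - ∫ w, f w ∂(unitLaw d)|}
      = {W | D * η ≤ |X W - ∫ W, X W ∂(sampleLaw D d)|} := by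
    ext W
    simp only [Set.mem_ofPred_eq]
    rw [hmean]
    simp only [X, Finset.sum_apply]
    have : (1 / (D : ℝ)) * ∑ i, f (W i) - ∫ w, f w ∂(unitLaw d)
        = (∑ i, f (W i) - D * ∫ w, f w ∂(unitLaw d)) / D := by field_simp
    rw [this, abs_div, abs_of_pos hD', le_div_iff₀ hD', mul_comm]
  rw [hset, measureReal_def]
  refine (ENNReal.toReal_le_of_le_ofReal (div_nonneg (variance_nonneg _ _) (sq_nonneg _)) h).trans ?_
  rw [div_div, div_le_div_iff₀ (by positivity) (by positivity)]
  nlinarith [mul_le_mul_of_nonneg_right hvar (by positivity : 0 ≤ η ^ 2 * D)]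

/-- The `ℓ¹` norm of a weight vector, an envelope for the ReLU features. -/
def envelope (w : Fin (d + 1) → ℝ) : ℝ := ∑ j, |w j|

theorem envelope_nonneg (w : Fin (d + 1) → ℝ) : 0 ≤ envelope w :=
  Finset.sum_nonneg fun _ _ => abs_nonneg _

theorem memLp_envelope {r : ℝ≥0∞} (hr : r ≠ ∞) :
    MemLp (envelope (d := d)) r (unitLaw d) :=
  memLp_finsetSum _ fun j _ => (memLp_coord j hr).abs

theorem abs_dotProduct_le_envelope (w v : Fin (d + 1) → ℝ) {c : ℝ} (hv : ∀ j, |v j| ≤ c) :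
    |w ⬝ᵥ v| ≤ c * envelope w := by
  unfold dotProduct envelope
  refine (Finset.abs_sum_le_sum_abs _ _).trans ?_
  rw [Finset.mul_sum]
  refine Finset.sum_le_sum fun j _ => ?_
  rw [abs_mul, mul_comm]
  exact mul_le_mul_of_nonneg_right (hv j) (abs_nonneg _)

theorem abs_coord_le_norm (x : EuclideanSpace ℝ (Fin d)) (i : Fin d) : |x i| ≤ ‖x‖ := by
  simpa using PiLp.norm_apply_le x i

theorem one_div_sqrt_two_le : 1 / √(2 : ℝ) ≤ 1 := by
  rw [div_le_one (by positivity)]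
  exact Real.one_le_sqrt.2 (by norm_num)

theorem abs_reluFeature_le {x : EuclideanSpace ℝ (Fin d)} (hx : ‖x‖ = 1) (w : Fin (d + 1) → ℝ) :
    |reluFeature x w| ≤ envelope w := by
  refine (abs_relu_le _).trans ((abs_dotProduct_le_envelope w _ (c := 1) fun j => ?_).trans
    (one_mul _).le)
  have h2 := one_div_sqrt_two_le
  have h3 : 0 < 1 / √(2 : ℝ) := by positivity
  refine Fin.lastCases ?_ (fun i => ?_) j
  · rw [augment, Fin.snoc_last, abs_of_pos h3]
    exact h2
  · rw [augment, Fin.snoc_castSucc, div_eq_mul_one_div, abs_mul, abs_of_pos h3]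
    exact mul_le_one₀ ((abs_coord_le_norm x i).trans hx.le) h3.le h2

theorem abs_relu_sub_le (s t : ℝ) : |relu s - relu t| ≤ |s - t| := by
  unfold relu
  exact abs_max_sub_max_le_abs s t 0

theorem abs_reluFeature_sub_le (x y : EuclideanSpace ℝ (Fin d)) (w : Fin (d + 1) → ℝ) :
    |reluFeature x w - reluFeature y w| ≤ ‖x - y‖ * envelope w := by
  refine (abs_relu_sub_le _ _).trans ?_
  rw [← dotProduct_sub]
  refine abs_dotProduct_le_envelope w _ fun j => ?_
  have h2 := one_div_sqrt_two_le
  have h3 : 0 < 1 / √(2 : ℝ) := by positivity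
  refine Fin.lastCases ?_ (fun i => ?_) j
  · simp [augment]
  · rw [Pi.sub_apply, augment, augment, Fin.snoc_castSucc, Fin.snoc_castSucc, ← sub_div,
      div_eq_mul_one_div, abs_mul, abs_of_pos h3]
    exact (mul_le_of_le_one_right (abs_nonneg _) h2).trans (abs_coord_le_norm (x - y) i)

/-- Truncation at level `M`. -/
def cutoff (M t : ℝ) : ℝ := if |t| ≤ M then t else 0

theorem measurable_cutoff (M : ℝ) : Measurable (cutoff M) :=
  Measurable.ite (measurableSet_le measurable_id.abs measurable_const) measurable_id
    measurable_const

theorem abs_cutoff_le {M : ℝ} (hM : 0 ≤ M) (t : ℝ) : |cutoff M t| ≤ M := by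
  unfold cutoff; split_ifs with h
  · exact h
  · simpa using hM

theorem sq_cutoff_le (M t : ℝ) : cutoff M t ^ 2 ≤ t ^ 2 := by
  unfold cutoff; split_ifs with h
  · exact le_rfl
  · simpa using sq_nonneg t

/-- When `|t| > L²`, either `e ≤ L` and the product is controlled by `t²`, or `e ≥ L` and it is
controlled by `|t| e²`. The integrated form depends on `a` only through its second moment, so one
truncation level serves all `a` at once. -/
theorem abs_sub_cutoff_mul_le {L : ℝ} (hL : 0 < L) (t : ℝ) {e : ℝ} (he : 0 ≤ e) :
    |t - cutoff (L ^ 2) t| * e ≤ (3 * t ^ 2 + e ^ 4) / (2 * L) := by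
  unfold cutoff
  split_ifs with h
  · rw [sub_self, abs_zero, zero_mul]; positivity
  · rw [sub_zero, le_div_iff₀ (by positivity)]
    have h' := (not_le.1 h).le
    have ht : t ^ 2 = |t| ^ 2 := (sq_abs t).symm
    rw [ht]
    have ha := abs_nonneg t
    rcases le_total e L with h1 | h1
    · have h3 : |t| * e * (2 * L) ≤ 2 * |t| * L ^ 2 := by
          nlinarith [mul_le_mul_of_nonneg_left h1 (by positivity : 0 ≤ |t| * L)]
      have h4 : |t| * L ^ 2 ≤ |t| ^ 2 := by nlinarith
      have : 0 ≤ e ^ 4 := by positivity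
      nlinarith
    · have h3 : |t| * e * (2 * L) ≤ 2 * |t| * e ^ 2 := by
          nlinarith [mul_le_mul_of_nonneg_left h1 (by positivity : 0 ≤ |t| * e)]
      nlinarith [sq_nonneg (|t| - e ^ 2), sq_nonneg |t|, show (e ^ 2) ^ 2 = e ^ 4 by ring]

theorem abs_integral_sub_cutoff_le {a : (Fin (d + 1) → ℝ) → ℝ} (ha : MemLp a 2 (unitLaw d))
    {L : ℝ} (hL : 0 < L) {x : EuclideanSpace ℝ (Fin d)} (hx : ‖x‖ = 1) :
    |∫ w, a w * reluFeature x w ∂(unitLaw d)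
        - ∫ w, cutoff (L ^ 2) (a w) * reluFeature x w ∂(unitLaw d)|
      ≤ (3 * ∫ w, a w ^ 2 ∂(unitLaw d) + ∫ w, envelope w ^ 4 ∂(unitLaw d)) / (2 * L) := by
  have hx2 := memLp_reluFeature x (r := 2) ENNReal.ofNat_ne_top
  have hc : MemLp (fun w => cutoff (L ^ 2) (a w)) 2 (unitLaw d) :=
    ha.mono ((measurable_cutoff _).comp_aemeasurable ha.1.aemeasurable).aestronglyMeasurable
      (.of_forall fun w => by
        rw [Real.norm_eq_abs, Real.norm_eq_abs]
        exact sq_le_sq.1 (sq_cutoff_le _ _))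
  have h4 : Integrable (fun w : Fin (d + 1) → ℝ => envelope w ^ 4) (unitLaw d) := by
    have := (memLp_envelope (d := d) (r := 4) ENNReal.ofNat_ne_top).integrable_norm_pow
      (by norm_num)
    refine this.congr (.of_forall fun w => ?_)
    simp only [Real.norm_eq_abs, abs_of_nonneg (envelope_nonneg w)]
  have j1 : Integrable (fun w => a w * reluFeature x w) (unitLaw d) := ha.integrable_mul hx2
  have j2 : Integrable (fun w => cutoff (L ^ 2) (a w) * reluFeature x w) (unitLaw d) :=
    hc.integrable_mul hx2
  rw [← integral_sub j1 j2]
  refine abs_integral_le_integral_abs.trans ?_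
  rw [← integral_const_mul, ← integral_add (ha.integrable_sq.const_mul 3) h4,
    ← integral_div]
  refine integral_mono (j1.sub j2).abs
    (((ha.integrable_sq.const_mul 3).add h4).div_const _) fun w => ?_
  refine le_trans ?_ (abs_sub_cutoff_mul_le hL (a w) (envelope_nonneg w))
  change |a w * reluFeature x w - cutoff (L ^ 2) (a w) * reluFeature x w| ≤ _
  rw [← sub_mul, abs_mul]
  exact mul_le_mul_of_nonneg_left (abs_reluFeature_le hx w) (abs_nonneg _)

/-- A sufficiently wide random layer approximates, uniformly on the unit sphere, any function
represented by the infinitely wide layer, with essentially the same norm. -/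
theorem exists_width (d : ℕ) (ρ : ℝ) {η δ : ℝ} (hη : 0 < η) (hδ : 0 < δ) :
    ∃ D₀ : ℕ, ∀ D : ℕ, D₀ ≤ D → ∀ (a : (Fin (d + 1) → ℝ) → ℝ)
      (h : EuclideanSpace ℝ (Fin d) → ℝ), IsReluRepresentation a h →
      ∫ w, a w ^ 2 ∂(unitLaw d) ≤ ρ →
      layerLaw D d {C | ¬ ∃ b : Fin D → ℝ, ∑ i, b i ^ 2 ≤ ∫ w, a w ^ 2 ∂(unitLaw d) + η ∧
        ∀ x, ‖x‖ = 1 → |b ⬝ᵥ reluLayer C x - h x| ≤ η} ≤ ENNReal.ofReal δ := by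
  set E1 := ∫ w : Fin (d + 1) → ℝ, envelope w ∂(unitLaw d)
  set E2 := ∫ w : Fin (d + 1) → ℝ, envelope w ^ 2 ∂(unitLaw d)
  set E4 := ∫ w : Fin (d + 1) → ℝ, envelope w ^ 4 ∂(unitLaw d)
  have hE1 : 0 ≤ E1 := integral_nonneg fun w => envelope_nonneg w
  have hE2 : 0 ≤ E2 := integral_nonneg fun w => sq_nonneg _
  have hE4 : 0 ≤ E4 := integral_nonneg fun w => by positivity
  have henv1 : Integrable (envelope (d := d)) (unitLaw d) :=
    (memLp_envelope (r := 1) ENNReal.one_ne_top).integrable le_rfl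
  have henv2 := memLp_envelope (d := d) (r := 2) ENNReal.ofNat_ne_top
  -- The error `η` is split into four quarters: truncation, sampling at a net point, and moving to
  -- the net point in the empirical mean and in the integral. `L` settles the first and the mesh `κ`
  -- the last two.
  set L := (3 * |ρ| + E4) / (2 * (η / 4)) + 1
  have hL : 0 < L := by positivity
  set M := L ^ 2
  have hM : 0 < M := by positivity
  set κ := η / (4 * (M * (E1 + 1)))
  have hκ : 0 < κ := by positivity
  obtain ⟨t, hts, htf, hcov⟩ :=
    finite_cover_balls_of_compact (isCompact_sphere (0 : EuclideanSpace ℝ (Fin d)) 1) hκ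
  set net := htf.toFinset
  -- The Chebyshev constants of the three kinds of bad events: values at net points, the mean
  -- envelope (a Lipschitz constant), and the norm of the weights.
  set Q := net.card * (M ^ 2 * E2 / (η / 4) ^ 2) + E2 / 1 ^ 2 + M ^ 4 / η ^ 2
  have hQ : 0 ≤ Q := by positivity
  refine ⟨⌈Q / δ⌉₊ + 1, fun D hD a h ha hρ => ?_⟩
  have hD0 : 0 < D := by omega
  have hD' : (0 : ℝ) < D := by exact_mod_cast hD0
  have hQD : Q / D ≤ δ := by
    rw [div_le_iff₀ hD', mul_comm, ← div_le_iff₀ hδ]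
    refine (Nat.le_ceil _).trans ?_
    exact_mod_cast (by omega : ⌈Q / δ⌉₊ ≤ D)
  have hxn : ∀ x ∈ net, ‖x‖ = 1 := fun x hx => by
    simpa using hts (htf.mem_toFinset.1 hx)
  set c : (Fin (d + 1) → ℝ) → ℝ := fun w => cutoff M (a w)
  have hcM : ∀ w, |c w| ≤ M := fun w => abs_cutoff_le hM.le _
  have hcmeas : AEStronglyMeasurable c (unitLaw d) :=
    ((measurable_cutoff _).comp_aemeasurable ha.1.1.aemeasurable).aestronglyMeasurable
  have hc2 : MemLp c 2 (unitLaw d) := ha.1.mono hcmeas (.of_forall fun w => by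
    rw [Real.norm_eq_abs, Real.norm_eq_abs]
    exact sq_le_sq.1 (sq_cutoff_le _ _))
  have hcx : ∀ x : EuclideanSpace ℝ (Fin d), ‖x‖ = 1 →
      MemLp (fun w => c w * reluFeature x w) 2 (unitLaw d) := fun x hx =>
    (henv2.const_mul M).mono
      (hcmeas.mul (continuous_reluFeature x).aestronglyMeasurable)
      (.of_forall fun w => by
        rw [norm_mul, Real.norm_eq_abs, Real.norm_eq_abs, Real.norm_of_nonneg
          (mul_nonneg hM.le (envelope_nonneg w))]
        exact mul_le_mul (hcM w) (abs_reluFeature_le hx w) (abs_nonneg _) hM.le)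
  have hcc : MemLp (fun w => c w ^ 2) 2 (unitLaw d) :=
    MemLp.of_bound (hcmeas.pow 2) (M ^ 2) (.of_forall fun w => by
      rw [norm_pow, Real.norm_eq_abs]
      exact pow_le_pow_left₀ (abs_nonneg _) (hcM w) 2)
  set A1 : EuclideanSpace ℝ (Fin d) → Set (Fin D → Fin (d + 1) → ℝ) := fun x =>
    {W | η / 4 ≤ |(1 / (D : ℝ)) * ∑ i, c (W i) * reluFeature x (W i)
      - ∫ w, c w * reluFeature x w ∂(unitLaw d)|}
  set A2 : Set (Fin D → Fin (d + 1) → ℝ) :=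
    {W | 1 ≤ |(1 / (D : ℝ)) * ∑ i, envelope (W i) - E1|}
  set A3 : Set (Fin D → Fin (d + 1) → ℝ) :=
    {W | η ≤ |(1 / (D : ℝ)) * ∑ i, c (W i) ^ 2 - ∫ w, c w ^ 2 ∂(unitLaw d)|}
  have p1 : ∀ x ∈ net, (sampleLaw D d).real (A1 x) ≤ M ^ 2 * E2 / (η / 4) ^ 2 / D := by
    intro x hx
    refine sampleLaw_deviation_le (hcx x (hxn x hx)) hD0 (by positivity) ?_
    rw [← integral_const_mul]
    refine integral_mono (hcx x (hxn x hx)).integrable_sq (henv2.integrable_sq.const_mul _)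
      fun w => ?_
    simp only
    rw [mul_pow]
    exact mul_le_mul (sq_le_sq' (abs_le.1 (hcM w)).1 (abs_le.1 (hcM w)).2)
      (sq_le_sq.2 ((abs_reluFeature_le (hxn x hx) w).trans (le_abs_self _)))
      (sq_nonneg _) (sq_nonneg _)
  have p2 : (sampleLaw D d).real A2 ≤ E2 / 1 ^ 2 / D :=
    sampleLaw_deviation_le henv2 hD0 one_pos le_rfl
  have p3 : (sampleLaw D d).real A3 ≤ M ^ 4 / η ^ 2 / D := by
    refine sampleLaw_deviation_le hcc hD0 hη ?_
    refine (integral_mono hcc.integrable_sq (integrable_const (M ^ 4)) fun w => ?_).trans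
      (by simp)
    simp only
    rw [← pow_mul, ← (even_two_mul 2).pow_abs]
    exact pow_le_pow_left₀ (abs_nonneg _) (hcM w) _
  rw [layerLaw_apply hD0]
  have hsub : {W : Fin D → Fin (d + 1) → ℝ | (√D)⁻¹ • W ∈ {C | ¬ ∃ b : Fin D → ℝ,
      ∑ i, b i ^ 2 ≤ ∫ w, a w ^ 2 ∂(unitLaw d) + η ∧
      ∀ x, ‖x‖ = 1 → |b ⬝ᵥ reluLayer C x - h x| ≤ η}} ⊆ (⋃ x ∈ net, A1 x) ∪ A2 ∪ A3 := by
    intro W hW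
    by_contra hcon
    simp only [Set.mem_union, Set.mem_iUnion, not_or, not_exists, A1, A2, A3, Set.mem_ofPred_eq,
      not_le] at hcon
    obtain ⟨⟨g1, g2⟩, g3⟩ := hcon
    apply hW
    have hs : 0 < √(D : ℝ) := Real.sqrt_pos.2 hD'
    -- One factor `1/√D` sits in these weights and one in the rows of `C`; by homogeneity of ReLU
    -- they combine into the `1/D` of an empirical mean.
    refine ⟨fun i => c (W i) / √D, ?_, fun x hx => ?_⟩
    · have e : ∑ i, (c (W i) / √D) ^ 2 = (1 / (D : ℝ)) * ∑ i, c (W i) ^ 2 := by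
        rw [Finset.mul_sum]
        refine Finset.sum_congr rfl fun i _ => ?_
        rw [div_pow, Real.sq_sqrt hD'.le]
        ring
      have h1 : ∫ w, c w ^ 2 ∂(unitLaw d) ≤ ∫ w, a w ^ 2 ∂(unitLaw d) :=
        integral_mono hc2.integrable_sq ha.1.integrable_sq fun w => sq_cutoff_le _ _
      rw [e]
      linarith [(abs_lt.1 g3).2]
    · have e : (fun i => c (W i) / √D) ⬝ᵥ reluLayer ((√D)⁻¹ • W) x
          = (1 / (D : ℝ)) * ∑ i, c (W i) * reluFeature x (W i) := by
        rw [dotProduct, Finset.mul_sum]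
        refine Finset.sum_congr rfl fun i _ => ?_
        simp only [reluLayer, Pi.smul_apply, smul_dotProduct, smul_eq_mul, reluFeature]
        rw [relu_mul_of_nonneg (inv_pos.2 hs).le]
        have : √(D : ℝ) * √D = D := Real.mul_self_sqrt hD'.le
        conv_rhs => rw [← this]
        field_simp
      obtain ⟨y, hy, hxy⟩ : ∃ y ∈ net, ‖x - y‖ < κ := by
        have := hcov (show x ∈ Metric.sphere 0 1 by simpa using hx)
        simp only [Set.mem_iUnion, Metric.mem_ball, dist_eq_norm] at this
        obtain ⟨y, hy, h⟩ := this
        exact ⟨y, htf.mem_toFinset.2 hy, h⟩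
      have hpt : ∀ w, |c w * reluFeature x w - c w * reluFeature y w| ≤ M * κ * envelope w := by
        intro w
        rw [← mul_sub, abs_mul, mul_assoc]
        refine mul_le_mul (hcM w) ((abs_reluFeature_sub_le x y w).trans ?_) (abs_nonneg _) hM.le
        exact mul_le_mul_of_nonneg_right hxy.le (envelope_nonneg w)
      have hMκ : M * κ * (E1 + 1) = η / 4 := by
        simp only [κ]
        field_simp
      have s1 : |(1 / (D : ℝ)) * ∑ i, c (W i) * reluFeature x (W i)
          - (1 / (D : ℝ)) * ∑ i, c (W i) * reluFeature y (W i)| ≤ η / 4 := by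
        rw [← mul_sub, ← Finset.sum_sub_distrib, abs_mul, abs_of_pos (by positivity)]
        calc _ ≤ (1 / (D : ℝ)) * ∑ i, M * κ * envelope (W i) := by
              gcongr
              exact (Finset.abs_sum_le_sum_abs _ _).trans (Finset.sum_le_sum fun i _ => hpt _)
          _ = M * κ * ((1 / (D : ℝ)) * ∑ i, envelope (W i)) := by
              rw [← Finset.mul_sum]; ring
          _ ≤ M * κ * (E1 + 1) := by
              gcongr
              linarith [(abs_lt.1 g2).2]
          _ = η / 4 := hMκ
      have i1 := (hcx x hx).integrable one_le_two
      have i2 := (hcx y (hxn y hy)).integrable one_le_two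
      have s2 : |∫ w, c w * reluFeature x w ∂(unitLaw d)
          - ∫ w, c w * reluFeature y w ∂(unitLaw d)| ≤ η / 4 := by
        rw [← integral_sub i1 i2]
        refine abs_integral_le_integral_abs.trans ?_
        calc _ ≤ ∫ w, M * κ * envelope w ∂(unitLaw d) :=
              integral_mono (i1.sub i2).abs (henv1.const_mul _) hpt
          _ = M * κ * E1 := integral_const_mul _ _
          _ ≤ M * κ * (E1 + 1) := by gcongr; linarith
          _ = η / 4 := hMκ
      have s3 := g1 y hy
      have s4 : |h x - ∫ w, c w * reluFeature x w ∂(unitLaw d)| ≤ η / 4 := by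
        rw [ha.2 x hx]
        refine (abs_integral_sub_cutoff_le ha.1 hL hx).trans ?_
        rw [div_le_iff₀ (by positivity)]
        have hLη : L * (2 * (η / 4)) = (3 * |ρ| + E4) + 2 * (η / 4) := by
          simp only [L]
          field_simp
        linarith [le_abs_self ρ]
      rw [e]
      rw [abs_le] at s1 s2 s4 ⊢
      rw [abs_lt] at s3
      constructor <;> linarith [s1.1, s1.2, s2.1, s2.2, s3.1, s3.2, s4.1, s4.2]
  refine (measure_mono hsub).trans ?_
  rw [← ofReal_measureReal]
  refine ENNReal.ofReal_le_ofReal (le_trans ?_ hQD)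
  refine (measureReal_union_le _ _).trans ((add_le_add (measureReal_union_le _ _) p3).trans ?_)
  have p1' := (measureReal_biUnion_finset_le (μ := sampleLaw D d) net A1).trans
    (Finset.sum_le_sum p1)
  rw [Finset.sum_const, nsmul_eq_mul] at p1'
  refine (add_le_add (add_le_add p1' p2) le_rfl).trans (le_of_eq ?_)
  simp only [Q]
  ring

end Sampling

/-! ### The ground truth and the choice of parameters. -/

section GroundTruth

theorem log_two_ge_half : 1 / 2 ≤ Real.log 2 := by
  have := Real.log_two_gt_d9; linarith

/-- For each label the squared weights sum to `1/2 + (m-1)/(2(m-1)) = 1`, so the loss is an average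
of coordinate errors. -/
theorem weightedSquareLoss_le {m n T D d : ℕ} (hm : 2 ≤ m) (hn : 1 ≤ n)
    (A : Matrix (Fin m) (Fin T) ℝ) (B : Matrix (Fin T) (Fin D) ℝ) (C : Fin D → Fin (d + 1) → ℝ)
    (x : Fin n → Fin m → EuclideanSpace ℝ (Fin d)) {e : ℝ}
    (h : ∀ i l j, ((Pi.single l 1 : Fin m → ℝ) j - prediction A B C (x i l) j) ^ 2 ≤ e) :
    weightedSquareLoss A B C x ≤ e := by
  have hm' : (0 : ℝ) < (m : ℝ) - 1 := by
    have : (2 : ℝ) ≤ m := by exact_mod_cast hm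
    linarith
  have hm0 : (0 : ℝ) < m := by linarith
  have hn0 : (0 : ℝ) < n := by exact_mod_cast hn
  have hw : ∀ l : Fin m, ∑ j, classWeight l j ^ 2 = 1 := by
    intro l
    rw [← Finset.add_sum_erase _ _ (Finset.mem_univ l)]
    have h1 : ∀ j ∈ Finset.univ.erase l, classWeight l j ^ 2 = 1 / (2 * ((m : ℝ) - 1)) := by
      intro j hj
      rw [classWeight, if_neg (Finset.ne_of_mem_erase hj), Real.sq_sqrt (by positivity)]
    rw [Finset.sum_congr rfl h1, Finset.sum_const, Finset.card_erase_of_mem (Finset.mem_univ l),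
      Finset.card_univ, Fintype.card_fin, classWeight, if_pos rfl, Real.sq_sqrt (by norm_num),
      nsmul_eq_mul, Nat.cast_sub (by omega), Nat.cast_one]
    field_simp
    norm_num
  have hrow : ∀ l i, ∑ j : Fin m, (classWeight l j *
      ((Pi.single l 1 : Fin m → ℝ) j - prediction A B C (x i l) j)) ^ 2 ≤ e := by
    intro l i
    calc _ ≤ ∑ j : Fin m, classWeight l j ^ 2 * e := by
          refine Finset.sum_le_sum fun j _ => ?_
          rw [mul_pow]
          exact mul_le_mul_of_nonneg_left (h i l j) (sq_nonneg _)
      _ = e := by rw [← Finset.sum_mul, hw, one_mul]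
  unfold weightedSquareLoss
  have havg : ∀ l : Fin m, (1 / (n : ℝ)) * ∑ i : Fin n, ∑ j : Fin m, (classWeight l j *
      ((Pi.single l 1 : Fin m → ℝ) j - prediction A B C (x i l) j)) ^ 2 ≤ e := by
    intro l
    rw [one_div, inv_mul_le_iff₀ hn0]
    refine (Finset.sum_le_sum fun i _ => hrow l i).trans (le_of_eq ?_)
    simp
  rw [one_div, inv_mul_le_iff₀ hm0]
  refine (Finset.sum_le_sum fun l _ => havg l).trans (le_of_eq ?_)
  simp

/-- If the representation is close to a scaled near-orthonormal system on the manifolds, then the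
transposed system is a good classifier and the representation is a geometry sensitive hash. -/
theorem exists_groundTruth_of_approx {m n T D d : ℕ} (hm : 2 ≤ m) (hn : 1 ≤ n) (hT : 0 < T)
    {ε : ℝ} (hε : 0 < ε) (hε2 : ε ≤ 1 / 2) (u : Fin m → Fin T → ℝ)
    (hself : ∀ l, |u l ⬝ᵥ u l - 1| ≤ √ε / 8) (hcross : ∀ l j, l ≠ j → |u l ⬝ᵥ u j| ≤ √ε / 4)
    (M : Fin m → Set (EuclideanSpace ℝ (Fin d))) (x : Fin n → Fin m → EuclideanSpace ℝ (Fin d))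
    (hx : ∀ i l, x i l ∈ M l) (B : Matrix (Fin T) (Fin D) ℝ) (C : Fin D → Fin (d + 1) → ℝ)
    (happ : ∀ l, ∀ p ∈ M l, ∀ t, |(B *ᵥ reluLayer C p) t - u l t / √ε| ≤ √ε / (16 * T)) :
    ∃ A : Matrix (Fin m) (Fin T) ℝ, weightedSquareLoss A B C x ≤ ε ∧ frobeniusSq A ≤ m ∧
      IsGSH M (representation B C) ε (1 / 4 / ε) := by
  have hTr : (1 : ℝ) ≤ T := by exact_mod_cast hT
  have hs : 0 < √ε := Real.sqrt_pos.2 hε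
  have hs2 : √ε ^ 2 = ε := Real.sq_sqrt hε.le
  have hs1 : √ε ≤ 1 := Real.sqrt_le_one.2 (by linarith)
  set w := √ε with hw
  have hnorm : ∀ l, ∑ t, u l t ^ 2 = u l ⬝ᵥ u l := fun l => by simp [dotProduct, sq]
  have hη2 : T * (w / (16 * T)) ^ 2 ≤ ε / 256 := by
    rw [div_pow, mul_pow, hs2, mul_div_assoc', div_le_div_iff₀ (by positivity) (by norm_num)]
    nlinarith [mul_pos hε (by linarith : (0 : ℝ) < T)]
  -- The factor `√ε` cancels the `1/√ε` in the representation, and it keeps each row of `A` at norm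
  -- at most `1`.
  refine ⟨fun j t => w * u j t, ?_, ?_, ?_, ?_⟩
  · refine weightedSquareLoss_le hm hn _ B C x fun i l j => ?_
    set e : Fin T → ℝ := fun t => (B *ᵥ reluLayer C (x i l)) t - u l t / w
    have hpred : prediction (fun j t => w * u j t) B C (x i l) j
        = u l ⬝ᵥ u j + w * ∑ t, u j t * e t := by
      change ∑ t, w * u j t * (B *ᵥ reluLayer C (x i l)) t = _
      rw [dotProduct, Finset.mul_sum, ← Finset.sum_add_distrib]
      refine Finset.sum_congr rfl fun t _ => ?_
      simp only [e]
      field_simp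
      ring
    have herr : |w * ∑ t, u j t * e t| ≤ w / 8 := by
      rw [abs_mul, abs_of_pos hs]
      have h1 : |∑ t, u j t * e t| ≤ 1 / 8 := by
        refine (Finset.abs_sum_le_sum_abs _ _).trans ?_
        have h2 : ∀ t ∈ Finset.univ, |u j t * e t| ≤ 2 * (w / (16 * T)) := by
          intro t _
          rw [abs_mul]
          refine mul_le_mul ?_ (happ l _ (hx i l) t) (abs_nonneg _) (by norm_num)
          refine abs_le_of_sq_le_sq ?_ (by norm_num)
          have := Finset.single_le_sum (f := fun t => u j t ^ 2) (fun t _ => sq_nonneg _)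
            (Finset.mem_univ t)
          have h3 := (abs_le.1 (hself j)).2
          rw [← hnorm j] at h3
          linarith
        refine (Finset.sum_le_sum h2).trans ?_
        rw [Finset.sum_const, Finset.card_univ, Fintype.card_fin, nsmul_eq_mul]
        have : (T : ℝ) * (2 * (w / (16 * T))) = w / 8 := by field_simp; norm_num
        rw [this]
        linarith
      nlinarith
    rw [hpred]
    have hb := abs_le.1 herr
    have key : |(Pi.single l 1 : Fin m → ℝ) j - (u l ⬝ᵥ u j + w * ∑ t, u j t * e t)| ≤ w := by
      rcases eq_or_ne l j with rfl | hlj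
      · rw [Pi.single_eq_same]
        have := abs_le.1 (hself l)
        rw [abs_le]
        constructor <;> linarith [this.1, this.2, hb.1, hb.2]
      · rw [Pi.single_eq_of_ne hlj.symm]
        have := abs_le.1 (hcross l j hlj)
        rw [abs_le]
        constructor <;> linarith [this.1, this.2, hb.1, hb.2]
    rw [← hs2]
    exact sq_le_sq' (abs_le.1 key).1 (abs_le.1 key).2
  · unfold frobeniusSq
    have : ∀ j, ∑ t, (w * u j t) ^ 2 ≤ 1 := by
      intro j
      simp only [mul_pow, ← Finset.mul_sum, hnorm, hs2]
      have h3 := abs_le.1 (hself j)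
      nlinarith [h3.2]
    refine (Finset.sum_le_sum fun j _ => this j).trans ?_
    simp
  · intro l p hp q hq
    rw [EuclideanSpace.real_norm_sq_eq]
    have h1 : ∀ t ∈ Finset.univ, (representation B C p - representation B C q) t ^ 2
        ≤ 4 * (w / (16 * T)) ^ 2 := by
      intro t _
      have a1 := abs_le.1 (happ l p hp t)
      have a2 := abs_le.1 (happ l q hq t)
      rw [show 4 * (w / (16 * T)) ^ 2 = (2 * (w / (16 * T))) ^ 2 by ring]
      simp only [representation, PiLp.sub_apply]
      exact sq_le_sq' (by linarith [a1.1, a2.2]) (by linarith [a1.2, a2.1])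
    refine (Finset.sum_le_sum h1).trans ?_
    rw [Finset.sum_const, Finset.card_univ, Fintype.card_fin, nsmul_eq_mul]
    linarith
  · intro l j hlj p hp q hq
    rw [EuclideanSpace.real_norm_sq_eq]
    have h1 : ∀ t ∈ Finset.univ, (u l t - u j t) ^ 2 / (2 * ε) - 4 * (w / (16 * T)) ^ 2
        ≤ (representation B C p - representation B C q) t ^ 2 := by
      intro t _
      have a1 := abs_le.1 (happ l p hp t)
      have a2 := abs_le.1 (happ j q hq t)
      simp only [representation, PiLp.sub_apply]
      set a := (B *ᵥ reluLayer C p) t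
      set b := (B *ᵥ reluLayer C q) t
      set Δ := u l t / w - u j t / w
      have e1 : (u l t - u j t) ^ 2 / (2 * ε) = Δ ^ 2 / 2 := by
        rw [← hs2]
        simp only [Δ]
        field_simp
      have e2 : (a - b - Δ) ^ 2 ≤ 4 * (w / (16 * T)) ^ 2 := by
        rw [show 4 * (w / (16 * T)) ^ 2 = (2 * (w / (16 * T))) ^ 2 by ring]
        exact sq_le_sq' (by simp only [Δ]; linarith [a1.1, a2.2])
          (by simp only [Δ]; linarith [a1.2, a2.1])
      rw [e1]
      -- With `e = a - b - Δ` this is `(Δ + e)² ≥ Δ²/2 - e²`.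
      nlinarith [sq_nonneg (2 * (a - b - Δ) + Δ)]
    refine le_trans ?_ (Finset.sum_le_sum h1)
    rw [Finset.sum_sub_distrib, Finset.sum_const, Finset.card_univ, Fintype.card_fin,
      nsmul_eq_mul, ← Finset.sum_div]
    have e3 : ∑ t, (u l t - u j t) ^ 2 = u l ⬝ᵥ u l + u j ⬝ᵥ u j - 2 * (u l ⬝ᵥ u j) := by
      simp only [dotProduct, Finset.mul_sum, ← Finset.sum_add_distrib, ← Finset.sum_sub_distrib]
      exact Finset.sum_congr rfl fun t _ => by ring
    -- The budget is `2 * (1 - 1/8) - 2 * (1/4)`, using `√ε ≤ 1`.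
    have h5 : 5 / 4 ≤ ∑ t, (u l t - u j t) ^ 2 := by
      rw [e3]
      have b1 := (abs_le.1 (hself l)).1
      have b2 := (abs_le.1 (hself j)).1
      have b3 := (abs_le.1 (hcross l j hlj)).2
      linarith
    have h6 : 5 / 4 / (2 * ε) ≤ (∑ t, (u l t - u j t) ^ 2) / (2 * ε) := by gcongr
    have h7 : 1 / 4 / ε + ε / 4 ≤ 5 / 4 / (2 * ε) := by
      rw [div_add' _ _ _ hε.ne', div_le_div_iff₀ hε (by positivity)]
      nlinarith
    linarith

variable {s d : ℕ}

/-- The degree `p` monomial feature of the identifier, in the coordinates `(γ / √2, 1 / √2)`. -/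
def monomialFeature (p : ℕ) (γ : EuclideanSpace ℝ (Fin s)) (α : Fin p → Fin (s + 1)) : ℝ :=
  ∏ i, augment γ (α i)

/-- The appended constant makes the base nonnegative for unit vectors, so even nearly antipodal
identifiers become almost orthogonal at high degree. -/
theorem monomialFeature_dotProduct (p : ℕ) (γ γ' : EuclideanSpace ℝ (Fin s)) :
    monomialFeature p γ ⬝ᵥ monomialFeature p γ' = ((1 + inner ℝ γ γ') / 2) ^ p := by
  rw [← augment_dotProduct_augment]
  unfold dotProduct monomialFeature
  rw [Fintype.sum_pow]
  exact Finset.sum_congr rfl fun α _ => Finset.prod_mul_distrib.symm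

/-- Each degree costs one multiplication by a coordinate, hence one factor `L * R₁`. The constants
depend on `R` only, not on the dimensions. -/
theorem exists_reluBound_monomialFeature (R : ℝ≥0) : ∃ c V : ℝ, 1 ≤ V ∧ 0 ≤ c ∧
    ∀ (s d : ℕ) (g : EuclideanSpace ℝ (Fin d) → EuclideanSpace ℝ (Fin s)),
      (∀ i, reluNorm (fun x => g x i) ≤ R) → ∀ (p : ℕ) (α : Fin p → Fin (s + 1)),
      ReluBound (fun x => monomialFeature p (g x) α) (c * V ^ p) := by
  obtain ⟨L, hL, hmul⟩ := exists_reluBound_mul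
  set c := 1 / √(reluCoeff 0)
  have hc : 0 ≤ c := by positivity
  set R₁ : ℝ := R + 1 + c
  have hR : (0 : ℝ) ≤ R := R.2
  have hR₁ : 1 ≤ R₁ := by simp only [R₁]; linarith
  have hs2 := one_div_sqrt_two_le
  have hs0 : 0 < 1 / √(2 : ℝ) := by positivity
  refine ⟨c, L * R₁, one_le_mul_of_one_le_of_one_le hL hR₁, hc, fun s d g hg => ?_⟩
  have hcoord : ∀ j, ReluBound (fun x => augment (g x) j) R₁ := by
    intro j
    refine Fin.lastCases ?_ (fun i => ?_) j
    · have h := (reluBound_one (d := d)).const_mul (1 / √2)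
      simp only [augment, Fin.snoc_last]
      simp only [mul_one] at h
      refine h.mono (by positivity) ?_
      rw [abs_of_pos hs0]
      have : 1 / √2 * c ≤ c := mul_le_of_le_one_left hc hs2
      simp only [R₁]
      change 1 / √2 * c ≤ _
      linarith
    · have h := (ReluBound.of_reluNorm_le (hg i)).const_mul (1 / √2)
      simp only [augment, Fin.snoc_castSucc, div_eq_mul_one_div (g _ i), mul_comm (g _ i)]
      refine h.mono (by positivity) ?_
      rw [abs_of_pos hs0]
      have : 1 / √2 * ((R : ℝ) + 1) ≤ R + 1 := mul_le_of_le_one_left (by positivity) hs2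
      simp only [R₁]
      linarith
  intro p
  induction p with
  | zero =>
    intro α
    simpa [monomialFeature, c] using reluBound_one (d := d)
  | succ p ih =>
    intro α
    have h := hmul d _ _ _ _ (hcoord (α 0)) (ih fun i => α i.succ)
    have e : L * (R₁ * (c * (L * R₁) ^ p)) = c * (L * R₁) ^ (p + 1) := by ring
    rw [e] at h
    simpa only [monomialFeature, Fin.prod_univ_succ] using h

/-- As `log s` and `log(1/ε)` are both at least `1/2`, the logarithm of each factor is at most a
constant times their product; `s + 1 ≤ s²` handles the number of monomials. -/
theorem exists_norm_exponent (Z W P : ℝ) (hZ : 1 ≤ Z) (hW : 1 ≤ W) (hP : 0 ≤ P) :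
    ∃ K : ℝ, 0 < K ∧ ∀ (ε : ℝ) (p s : ℕ), 0 < ε → ε ≤ 1 / 2 → 2 ≤ s →
      (p : ℝ) ≤ P * Real.log (1 / ε) →
      Z * ((s : ℝ) + 1) ^ (2 * p) * W ^ (2 * p) / ε ≤ (s : ℝ) ^ (K * Real.log (1 / ε)) := by
  have hlW : 0 ≤ Real.log W := Real.log_nonneg hW
  have hlZ : 0 ≤ Real.log Z := Real.log_nonneg hZ
  refine ⟨4 * P + 4 * P * Real.log W + 2 + 4 * Real.log Z, by positivity,
    fun ε p s hε hε2 hs hp => ?_⟩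
  have h2 := log_two_ge_half
  set ℓ := Real.log (1 / ε)
  have hℓ : 1 / 2 ≤ ℓ := h2.trans (Real.log_le_log (by norm_num) (by
    rw [le_div_iff₀ hε]; linarith))
  have hsr : (2 : ℝ) ≤ s := by exact_mod_cast hs
  have hs0 : (0 : ℝ) < s := by linarith
  set σ := Real.log s
  have hσ : 1 / 2 ≤ σ := h2.trans (Real.log_le_log (by norm_num) hsr)
  have e1 : ((s : ℝ) + 1) ^ (2 * p) ≤ Real.exp (4 * P * (ℓ * σ)) := by
    have h3 : (s : ℝ) + 1 ≤ s ^ 2 := by nlinarith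
    calc ((s : ℝ) + 1) ^ (2 * p) ≤ ((s : ℝ) ^ 2) ^ (2 * p) := by gcongr
      _ = Real.exp (4 * p * σ) := by
          rw [← pow_mul, ← Real.exp_log (pow_pos hs0 (2 * (2 * p))), Real.log_pow]
          congr 1
          push_cast
          ring
      _ ≤ _ := by
          apply Real.exp_le_exp.2
          nlinarith
  have e2 : W ^ (2 * p) ≤ Real.exp (4 * P * Real.log W * (ℓ * σ)) := by
    rw [← Real.exp_log (pow_pos (by linarith : 0 < W) (2 * p)), Real.log_pow]
    apply Real.exp_le_exp.2
    push_cast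
    calc 2 * (p : ℝ) * Real.log W ≤ 2 * (P * ℓ) * Real.log W := by gcongr
      _ = 4 * P * Real.log W * (ℓ * (1 / 2)) := by ring
      _ ≤ _ := by gcongr
  have e3 : 1 / ε ≤ Real.exp (2 * (ℓ * σ)) := by
    rw [← Real.exp_log (by positivity : 0 < 1 / ε)]
    apply Real.exp_le_exp.2
    change ℓ ≤ _
    nlinarith
  have e4 : Z ≤ Real.exp (4 * Real.log Z * (ℓ * σ)) := by
    conv_lhs => rw [← Real.exp_log (by linarith : 0 < Z)]
    apply Real.exp_le_exp.2
    have : 1 / 4 ≤ ℓ * σ := by nlinarith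
    nlinarith
  rw [Real.rpow_def_of_pos hs0]
  calc Z * ((s : ℝ) + 1) ^ (2 * p) * W ^ (2 * p) / ε
      = Z * ((s : ℝ) + 1) ^ (2 * p) * W ^ (2 * p) * (1 / ε) := by ring
    _ ≤ Real.exp (4 * Real.log Z * (ℓ * σ)) * Real.exp (4 * P * (ℓ * σ)) *
        Real.exp (4 * P * Real.log W * (ℓ * σ)) * Real.exp (2 * (ℓ * σ)) := by
        gcongr
    _ = _ := by
        rw [← Real.exp_add, ← Real.exp_add, ← Real.exp_add]
        congr 1
        change _ = σ * (_ * ℓ)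
        ring

theorem exists_degree (τ : ℝ) (hτ : τ < 1) : ∃ q P : ℝ, 0 ≤ P ∧ (1 + τ) / 2 ≤ q ∧ 0 ≤ q ∧
    ∀ ε : ℝ, 0 < ε → ε ≤ 1 / 2 → ∃ p : ℕ, (p : ℝ) ≤ P * Real.log (1 / ε) ∧ q ^ p ≤ √ε / 8 := by
  -- The maximum keeps `q` positive for every `τ < 1`, however negative.
  set q := max ((1 + τ) / 2) (1 / 2)
  have hq0 : 0 < q := lt_of_lt_of_le (by norm_num) (le_max_right _ _)
  have hq1 : q < 1 := max_lt (by linarith) (by norm_num)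
  have hlq : 0 < -Real.log q := neg_pos.2 (Real.log_neg hq0 hq1)
  set b := -Real.log q
  refine ⟨q, 7 / b + 2, by positivity, le_max_left _ _, hq0.le, fun ε hε hε2 => ?_⟩
  have h2 := log_two_ge_half
  set ℓ := Real.log (1 / ε)
  have hℓ2 : Real.log 2 ≤ ℓ := Real.log_le_log (by norm_num) (by
    rw [le_div_iff₀ hε]; linarith)
  refine ⟨⌈7 * ℓ / b⌉₊, ?_, ?_⟩
  · have h := (Nat.ceil_lt_add_one (by have : 0 ≤ ℓ := by linarith
                                       positivity : 0 ≤ 7 * ℓ / b)).le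
    refine h.trans ?_
    rw [add_mul, mul_div_assoc, mul_div_assoc']
    have : 7 / b * ℓ = 7 * ℓ / b := by ring
    rw [this]
    linarith
  · have h := Nat.le_ceil (7 * ℓ / b)
    rw [div_le_iff₀ hlq] at h
    have hs : 0 < √ε := Real.sqrt_pos.2 hε
    rw [← Real.log_le_log_iff (by positivity) (by positivity), Real.log_pow,
      Real.log_div hs.ne' (by norm_num), Real.log_sqrt hε.le]
    have h8 : Real.log 8 = 3 * Real.log 2 := by
      rw [show (8 : ℝ) = 2 ^ 3 by norm_num, Real.log_pow]; norm_num
    have hle : ℓ = -Real.log ε := by simp only [ℓ, one_div, Real.log_inv]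
    have : ((⌈7 * ℓ / b⌉₊ : ℕ) : ℝ) * Real.log q = -(⌈7 * ℓ / b⌉₊ * b) := by
      simp only [b]; ring
    rw [this, h8]
    linarith

theorem exists_hidden_width {m n : ℕ} {ε δ : ℝ} (hm : 2 ≤ m) (hn : 1 ≤ n) (hε : 0 < ε)
    (hε2 : ε ≤ 1 / 2) (hδ : 0 < δ) (hδ2 : δ ≤ 1 / 2) : ∃ T : ℕ, 0 < T ∧
    (T : ℝ) ≤ 5130 * (Real.log ((m : ℝ) * n) * Real.log (1 / δ) / ε) ∧
    4 * (m : ℝ) ^ 2 * Real.exp (-(T * (√ε / 8) ^ 2 / 8)) < 1 / 2 := by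
  have h2 := log_two_ge_half
  have hmr : (2 : ℝ) ≤ m := by exact_mod_cast hm
  have hnr : (1 : ℝ) ≤ n := by exact_mod_cast hn
  set lm := Real.log m
  have hlm2 : Real.log 2 ≤ lm := Real.log_le_log (by norm_num) hmr
  have hlm : 1 / 2 ≤ lm := h2.trans hlm2
  have hld : 1 / 2 ≤ Real.log (1 / δ) := h2.trans (Real.log_le_log (by norm_num) (by
    rw [le_div_iff₀ hδ]; linarith))
  have hlmn : lm ≤ Real.log ((m : ℝ) * n) := Real.log_le_log (by linarith) (by nlinarith)
  -- This gives `T ε / 512 > 5 log m ≥ log(8 m²)`. Only `log m` is needed: `n` and `δ` enter merely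
  -- through `log(1/δ) ≥ 1/2` and `log(mn) ≥ log m`, and `5130 / 2 = 2560 + 5` leaves room for the
  -- rounding.
  refine ⟨⌈2560 * lm / ε⌉₊ + 1, by omega, ?_, ?_⟩
  · have h := (Nat.ceil_lt_add_one (by positivity : 0 ≤ 2560 * lm / ε)).le
    have h3 : lm * (1 / 2) ≤ Real.log ((m : ℝ) * n) * Real.log (1 / δ) := by
      apply mul_le_mul hlmn hld (by norm_num) (by linarith)
    push_cast
    have h4 : 5130 * (lm * (1 / 2) / ε)
        ≤ 5130 * (Real.log ((m : ℝ) * n) * Real.log (1 / δ) / ε) := by gcongr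
    refine le_trans ?_ h4
    have h5 : 1 ≤ lm / ε := by rw [le_div_iff₀ hε]; linarith
    have h6 : 5130 * (lm * (1 / 2) / ε) = 2560 * lm / ε + 5 * (lm / ε) := by ring
    rw [h6]
    linarith
  · set T := ⌈2560 * lm / ε⌉₊ + 1
    have hT : 2560 * lm / ε < T := by
      have := Nat.le_ceil (2560 * lm / ε)
      simp only [T]
      push_cast
      linarith
    rw [div_lt_iff₀ hε] at hT
    have h7 : T * (√ε / 8) ^ 2 / 8 = T * ε / 512 := by
      rw [div_pow, Real.sq_sqrt hε.le]; ring
    rw [h7]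
    have h8 : Real.log (8 * (m : ℝ) ^ 2) = 3 * Real.log 2 + 2 * lm := by
      rw [Real.log_mul (by norm_num) (by positivity), Real.log_pow,
        show (8 : ℝ) = 2 ^ 3 by norm_num, Real.log_pow]
      push_cast
      ring
    have h9 : 8 * (m : ℝ) ^ 2 < Real.exp (T * ε / 512) := by
      rw [← Real.log_lt_iff_lt_exp (by positivity), h8]
      linarith
    rw [Real.exp_neg, ← div_eq_mul_inv, div_lt_iff₀ (Real.exp_pos _)]
    linarith

end GroundTruth

/-! ### Assembly. -/

/-- Linear combinations `∑ α, G α * (monomial α of g)` are represented by the infinitely wide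
layer, with norms controlled by the coefficients `G`. -/
theorem exists_representation_of_monomials {s d p : ℕ}
    {g : EuclideanSpace ℝ (Fin d) → EuclideanSpace ℝ (Fin s)} {b : ℝ} (hb : 0 ≤ b)
    (hg : ∀ α : Fin p → Fin (s + 1), ReluBound (fun x => monomialFeature p (g x) α) b)
    (G : (Fin p → Fin (s + 1)) → ℝ) :
    ∃ a : (Fin (d + 1) → ℝ) → ℝ,
      IsReluRepresentation a (fun x => G ⬝ᵥ monomialFeature p (g x)) ∧
      ∫ w, a w ^ 2 ∂(unitLaw d) ≤ ((s : ℝ) + 1) ^ p * b ^ 2 * ∑ α, G α ^ 2 := by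
  have h := ReluBound.sum Finset.univ (fun α _ => (hg α).const_mul (G α))
    (fun α _ => mul_nonneg (abs_nonneg _) hb)
  obtain ⟨a, ha, hn⟩ := h.exists_representation
    (Finset.sum_nonneg fun α _ => mul_nonneg (abs_nonneg _) hb)
  refine ⟨a, ha, hn.trans ?_⟩
  have hc := sq_sum_le_card_mul_sum_sq (s := Finset.univ)
    (f := fun α : Fin p → Fin (s + 1) => |G α| * b)
  refine hc.trans (le_of_eq ?_)
  simp only [Finset.card_univ, Fintype.card_fun, Fintype.card_fin, mul_pow, sq_abs,
    ← Finset.sum_mul]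
  push_cast
  ring

theorem mainTheorem2 :
    ∃ c K₀ : ℝ, 0 < c ∧ 0 < K₀ ∧
    ∀ (τ : ℝ) (R : ℝ≥0), τ < 1 → ∃ K : ℝ, 0 < K ∧
    ∀ (m n : ℕ) (ε δ : ℝ), 2 ≤ m → 1 ≤ n → 0 < ε → ε ≤ 1 / 2 → 0 < δ → δ ≤ 1 / 2 →
    ∃ T : ℕ, (T : ℝ) ≤ K₀ * (Real.log ((m : ℝ) * n) * Real.log (1 / δ) / ε) ∧
    ∀ s d : ℕ, 2 ≤ s → ∃ D₀ : ℕ, ∀ D : ℕ, D₀ ≤ D →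
    ∀ (k : ℕ)
      (f : EuclideanSpace ℝ (Fin s) → EuclideanSpace ℝ (Fin k) → EuclideanSpace ℝ (Fin d))
      (Θ : Set (EuclideanSpace ℝ (Fin k)))
      (g : EuclideanSpace ℝ (Fin d) → EuclideanSpace ℝ (Fin s))
      (γ : Fin m → EuclideanSpace ℝ (Fin s))
      (x : Fin n → Fin m → EuclideanSpace ℝ (Fin d)),
      (∀ l, ‖γ l‖ = 1) →
      (∀ l j, l ≠ j → inner ℝ (γ l) (γ j) ≤ τ) →
      (∀ l, ∀ p ∈ manifold f Θ (γ l), ‖p‖ = 1) →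
      (∀ l, ∀ p ∈ manifold f Θ (γ l), g p = γ l) →
      (∀ i, reluNorm (fun p => g p i) ≤ R) →
      (∀ i l, x i l ∈ manifold f Θ (γ l)) →
      layerLaw D d {C | ¬ ∃ (A : Matrix (Fin m) (Fin T) ℝ) (B : Matrix (Fin T) (Fin D) ℝ),
          weightedSquareLoss A B C x ≤ ε ∧
          frobeniusSq A ≤ m ∧
          frobeniusSq B ≤ (s : ℝ) ^ (K * Real.log (1 / ε)) ∧
          IsGSH (fun l => manifold f Θ (γ l)) (representation B C) ε (c / ε)}
        ≤ ENNReal.ofReal δ := by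
  refine ⟨1 / 4, 5130, by norm_num, by norm_num, fun τ R hτ => ?_⟩
  obtain ⟨q, P, hP, hτq, hq0, hdeg⟩ := exists_degree τ hτ
  obtain ⟨c, V, hV, hc, hmono⟩ := exists_reluBound_monomialFeature R
  -- The part `2 * c ^ 2` pays for the norm `ρ` of the ideal rows, and the `1` for the slack `T * η
  -- ≤ 1` from finite width.
  obtain ⟨K, hK, hexp⟩ := exists_norm_exponent (2 * c ^ 2 + 1) V P
    (by linarith [sq_nonneg c]) hV hP
  refine ⟨K, hK, fun m n ε δ hm hn hε hε2 hδ hδ2 => ?_⟩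
  obtain ⟨T, hT, hTle, hTexp⟩ := exists_hidden_width hm hn hε hε2 hδ hδ2
  obtain ⟨p, hp, hqp⟩ := hdeg ε hε hε2
  refine ⟨T, hTle, fun s d hs => ?_⟩
  have hTr : (0 : ℝ) < T := by exact_mod_cast hT
  have hsε : 0 < √ε := Real.sqrt_pos.2 hε
  have hsε1 : √ε ≤ 1 := Real.sqrt_le_one.2 (by linarith)
  set N : ℝ := ((s : ℝ) + 1) ^ p
  set b := c * V ^ p
  have hb : 0 ≤ b := by positivity
  -- All rows together: `N * b ^ 2` from Cauchy–Schwarz over the monomials, times the squared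
  -- entries of `G`, at most `2 * T * N`, rescaled by `1 / (T * ε)`. No training data enter, so the
  -- width can be fixed before them.
  set ρ := 2 * N ^ 2 * b ^ 2 / ε
  set η := √ε / (16 * T)
  obtain ⟨D₀, hD₀⟩ := exists_width d ρ (η := η) (δ := δ / T) (by positivity) (by positivity)
  refine ⟨D₀, fun D hD k f Θ g γ x hγ hsep hunit hinv hR hx => ?_⟩
  set φ : Fin m → (Fin p → Fin (s + 1)) → ℝ := fun l => monomialFeature p (γ l)
  have hφ : ∀ l, φ l ⬝ᵥ φ l = 1 := fun l => by
    simp only [φ]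
    rw [monomialFeature_dotProduct, real_inner_self_eq_norm_sq, hγ]
    norm_num
  have hφcross : ∀ l j, l ≠ j → 0 ≤ φ l ⬝ᵥ φ j ∧ φ l ⬝ᵥ φ j ≤ √ε / 8 := fun l j hlj => by
    have h0 : 0 ≤ (1 + inner ℝ (γ l) (γ j)) / 2 := by
      have h1 : |inner ℝ (γ l) (γ j)| ≤ 1 := by
        simpa [hγ] using abs_real_inner_le_norm (γ l) (γ j)
      linarith [(abs_le.1 h1).1]
    simp only [φ]
    rw [monomialFeature_dotProduct]
    refine ⟨pow_nonneg h0 p, (pow_le_pow_left₀ h0 ?_ p).trans hqp⟩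
    linarith [hsep l j hlj]
  -- `G` depends on the identifiers but not on `C`, so the target functions are fixed before the
  -- layer is sampled.
  obtain ⟨G, hG, hGinner⟩ := exists_matrix_preserving_inner φ hφ (w := √ε / 8) (by positivity)
    (by linarith) hT hTexp
  have hcardN : (Fintype.card (Fin p → Fin (s + 1)) : ℝ) = N := by
    simp [N]
  rw [hcardN] at hG
  set u : Fin m → Fin T → ℝ := fun l t => (√T)⁻¹ * (G t ⬝ᵥ φ l)
  have hu : ∀ l j, u l ⬝ᵥ u j = (1 / (T : ℝ)) * ∑ t, (G t ⬝ᵥ φ l) * (G t ⬝ᵥ φ j) := by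
    intro l j
    rw [dotProduct, Finset.mul_sum]
    refine Finset.sum_congr rfl fun t _ => ?_
    have : (√(T : ℝ))⁻¹ * (√(T : ℝ))⁻¹ = 1 / T := by
      rw [← mul_inv, Real.mul_self_sqrt hTr.le, one_div]
    rw [← this]
    simp only [u]
    ring
  have hself : ∀ l, |u l ⬝ᵥ u l - 1| ≤ √ε / 8 := fun l => by
    have := hGinner l l
    rwa [hφ, ← hu] at this
  have hcross : ∀ l j, l ≠ j → |u l ⬝ᵥ u j| ≤ √ε / 4 := fun l j hlj => by
    have h1 := abs_le.1 (hGinner l j)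
    rw [← hu] at h1
    have h2 := hφcross l j hlj
    rw [abs_le]
    constructor <;> linarith [h1.1, h1.2, h2.1, h2.2]
  set r := (√(T : ℝ))⁻¹ / √ε
  have hr2 : r ^ 2 = 1 / (T * ε) := by
    simp only [r]
    rw [div_pow, inv_pow, Real.sq_sqrt hTr.le, Real.sq_sqrt hε.le]
    field_simp
  choose a ha hanorm using fun t => exists_representation_of_monomials hb (hmono s d g hR p)
    (r • G t)
  have htotal : ∑ t, ∫ w, a t w ^ 2 ∂(unitLaw d) ≤ ρ := by
    refine (Finset.sum_le_sum fun t _ => hanorm t).trans ?_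
    simp only [Pi.smul_apply, smul_eq_mul, mul_pow, ← Finset.mul_sum, hr2]
    calc _ ≤ N * b ^ 2 * (1 / (T * ε) * (2 * (T * N))) := by gcongr
      _ = ρ := by simp only [ρ]; field_simp
  have hsingle : ∀ t, ∫ w, a t w ^ 2 ∂(unitLaw d) ≤ ρ := fun t =>
    (Finset.single_le_sum (f := fun t => ∫ w, a t w ^ 2 ∂(unitLaw d))
      (fun t _ => integral_nonneg fun w => sq_nonneg _) (Finset.mem_univ t)).trans htotal
  set bad : Fin T → Set (Fin D → Fin (d + 1) → ℝ) := fun t =>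
    {C | ¬ ∃ β : Fin D → ℝ, ∑ i, β i ^ 2 ≤ ∫ w, a t w ^ 2 ∂(unitLaw d) + η ∧
      ∀ y, ‖y‖ = 1 → |β ⬝ᵥ reluLayer C y - (r • G t) ⬝ᵥ monomialFeature p (g y)| ≤ η}
  have hbad : ∀ t, layerLaw D d (bad t) ≤ ENNReal.ofReal (δ / T) := fun t =>
    hD₀ D hD (a t) _ (ha t) (hsingle t)
  refine (measure_mono (t := ⋃ t, bad t) fun C hC => ?_).trans ?_
  · by_contra hcon
    have hgood : ∀ t, ∃ β : Fin D → ℝ, ∑ i, β i ^ 2 ≤ ∫ w, a t w ^ 2 ∂(unitLaw d) + η ∧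
        ∀ y, ‖y‖ = 1 → |β ⬝ᵥ reluLayer C y - (r • G t) ⬝ᵥ monomialFeature p (g y)| ≤ η :=
      fun t => by_contra fun h => hcon (Set.mem_iUnion.2 ⟨t, h⟩)
    choose B hBnorm hBapp using hgood
    apply hC
    obtain ⟨A, hloss, hA, hgsh⟩ := exists_groundTruth_of_approx hm hn hT hε hε2 u hself hcross
      (fun l => manifold f Θ (γ l)) x hx B C fun l y hy t => by
        have h := hBapp t y (hunit l y hy)
        rw [hinv l y hy, smul_dotProduct] at h
        have e : r • (G t ⬝ᵥ monomialFeature p (γ l)) = u l t / √ε := by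
          simp only [r, u, φ, smul_eq_mul]
          ring
        rw [e] at h
        exact h
    refine ⟨A, B, hloss, hA, ?_, hgsh⟩
    refine le_trans ?_ (hexp ε p s hε hε2 hs hp)
    have hη : T * η ≤ 1 := by
      have : T * η = √ε / 16 := by simp only [η]; field_simp
      rw [this]; linarith
    have h1 : frobeniusSq B ≤ ρ + 1 := by
      unfold frobeniusSq
      refine (Finset.sum_le_sum fun t _ => hBnorm t).trans ?_
      rw [Finset.sum_add_distrib, Finset.sum_const, Finset.card_univ, Fintype.card_fin,
        nsmul_eq_mul]
      linarith
    have hN1 : 1 ≤ N ^ 2 * (V ^ p) ^ 2 / ε := by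
      rw [le_div_iff₀ hε]
      have a1 : 1 ≤ N := one_le_pow₀ (by linarith [(Nat.cast_nonneg s : (0 : ℝ) ≤ s)])
      have a2 : 1 ≤ V ^ p := one_le_pow₀ hV
      have := one_le_mul_of_one_le_of_one_le (one_le_pow₀ a1 (n := 2)) (one_le_pow₀ a2 (n := 2))
      linarith
    refine h1.trans ?_
    have e : (2 * c ^ 2 + 1) * ((s : ℝ) + 1) ^ (2 * p) * V ^ (2 * p) / ε
        = ρ + N ^ 2 * (V ^ p) ^ 2 / ε := by
      simp only [ρ, N, b]
      ring
    rw [e]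
    linarith
  · refine (measure_iUnion_fintype_le _ _).trans ((Finset.sum_le_sum fun t _ => hbad t).trans ?_)
    rw [Finset.sum_const, Finset.card_univ, Fintype.card_fin, nsmul_eq_mul,
      ← ENNReal.ofReal_natCast, ← ENNReal.ofReal_mul hTr.le]
    exact ENNReal.ofReal_le_ofReal (le_of_eq (by field_simp))

end
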